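/- Let $-\infty\le a<b\le\infty$, let $V\in L^1_{\mathrm{loc}}(a,b)$ be real-valued, let $I\subseteq\mathbb Z$, and let $(x_n)_{n\in I}$ be distinct points of $(a,b)$ such that $M=\{x_n\}_{n\in I}$ has no accumulation point in $(a,b)$. For $\alpha,\theta\in\mathbb R$ and $r>0$ put $$A_{\alpha,r,\theta}=\begin{pmatrix}1&\alpha\\0&1\end{pmatrix}\begin{pmatrix}r&0\\0&1/r\end{pmatrix}\begin{pmatrix}\cos\theta&-\sin\theta\\\sin\theta&\cos\theta\end{pmatrix}\in \mathrm{SL}(2,\mathbb R).$$ Let $\Lambda=(\alpha_n)_{n\in I}\subset\mathbb R$, $R=(r_n)_{n\in I}\subset(0,\infty)$, $\Theta=(\theta_n)_{n\in I}\subset\mathbb R$ and $\tau f=-f''+Vf$. For $z\in\mathbb C$, a solution of $(\tau_{\Lambda,R,\Theta}-z)f=0$ on an open interval $J\subseteq(a,b)$ is a function $f:J\to\mathbb C$ such that $f,f'$ are locally absolutely continuous in $J\setminus M$, $\tau f=zf$ almost everywhere in $J$, and $$\begin{pmatrix}f(x_n+)\\f'(x_n+)\end{pmatrix}=A_{\alpha_n,r_n,\theta_n}\begin{pmatrix}f(x_n-)\\f'(x_n-)\end{pmatrix}\qquad(\ast)$$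 for all $n\in I$ with $x_n\in J$. We say that $\tau_{\Lambda,R,\Theta}$ is in the limit circle case at $a$ (resp. $b$) if, for every $z\in\mathbb C$, every solution of $(\tau_{\Lambda,R,\Theta}-z)f=0$ on $(a,b)$ is square integrable near $a$ (resp. $b$). Write $[f,g]_x=\overline{f(x+)}\,g'(x+)-\overline{f'(x+)}\,g(x+)$, and $[f,g]_a$, $[f,g]_b$ for its limits as $x\to a+$, $x\to b-$. Fix $\lambda\in\mathbb R$ and non-trivial real solutions $v$ and $w$ of $(\tau_{\Lambda,R,\Theta}-\lambda)u=0$ near $a$ and near $b$, respectively. Let $H_{\Lambda,R,\Theta}$ be the operator $f\mapsto\tau f$ in $L^2(a,b)$ whose domain consists of all $f\in L^2(a,b)$ such that $f,f'$ are locally absolutely continuous in $(a,b)\setminus M$, $\tau f\in L^2(a,b)$, $(\ast)$ holds for all $n\in I$, $[v,f]_a=0$ if $\tau_{\Lambda,R,\Theta}$ is in the limit circle case at $a$, and $[w,f]_b=0$ if it is in the limit circle case at $b$. Fix $n_0\in I$ and $E\in\mathbb R$. Keep $v$, $w$ and all parameters with index $n\ne n_0$ fixed, and let $H_{\alpha,r,\theta}$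 be the operator obtained when the parameters at $n_0$ are $(\alpha,r,\theta)$. Let $$P(E)=\{(\alpha,r,\theta)\in\mathbb R\times(0,\infty)\times\mathbb R : E \text{ is an eigenvalue of } H_{\alpha,r,\theta}\}.$$ Then: a) For all $\alpha_0\in\mathbb R$, $r_0>0$, the set $\{(\alpha_0,r_0,\theta)\in P(E):\theta\in\mathbb R\}$ is empty or countably infinite. b) For all $\alpha_0,\theta_0\in\mathbb R$, the set $\{(\alpha_0,r,\theta_0)\in P(E):r>0\}$ has at most one element or equals $\{\alpha_0\}\times(0,\infty)\times\{\theta_0\}$. c) For all $r_0>0$, $\theta_0\in\mathbb R$, the set $\{(\alpha,r_0,\theta_0)\in P(E):\alpha\in\mathbb R\}$ has at most one element or equals $\mathbb R\times\{r_0\}\times\{\theta_0\}$. -/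

import Mathlib

open Filter Topology MeasureTheory Set

noncomputable section

namespace PointInteraction

/-- The open interval `(a, b)` of real numbers, with possibly infinite endpoints. -/
def interval (a b : EReal) : Set ℝ := {t : ℝ | a < (t : EReal) ∧ (t : EReal) < b}

/-! ### The interaction matrices -/

/-- Parabolic factor. -/
def parabolic (α : ℝ) : Matrix (Fin 2) (Fin 2) ℝ := !![1, α; 0, 1]

/-- Hyperbolic factor (used for `0 < r`). -/
def hyperbolic (r : ℝ) : Matrix (Fin 2) (Fin 2) ℝ := !![r, 0; 0, 1 / r]

/-- Elliptic factor. -/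
def elliptic (θ : ℝ) : Matrix (Fin 2) (Fin 2) ℝ :=
  !![Real.cos θ, -Real.sin θ; Real.sin θ, Real.cos θ]

/-- The `SL(2, ℝ)` matrix with Iwasawa decomposition `P_α H_r E_θ`. -/
def interactionMatrix (α r θ : ℝ) : Matrix (Fin 2) (Fin 2) ℝ :=
  parabolic α * hyperbolic r * elliptic θ

/-- The three families `(α_n)`, `(r_n)`, `(θ_n)` of interaction parameters. -/
structure Couplings (I : Set ℤ) where
  alpha : I → ℝ
  r : I → ℝ
  theta : I → ℝ

namespace Couplings

/-- The interaction matrix at the `n`-th point. -/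
def matrix {I : Set ℤ} (κ : Couplings I) (n : I) : Matrix (Fin 2) (Fin 2) ℝ :=
  interactionMatrix (κ.alpha n) (κ.r n) (κ.theta n)

/-- Replace the parameters of the interaction `n₀`, keeping all the others. -/
def replaceAt {I : Set ℤ} (κ : Couplings I) (n₀ : I) (α r θ : ℝ) : Couplings I where
  alpha := Function.update κ.alpha n₀ α
  r := Function.update κ.r n₀ r
  theta := Function.update κ.theta n₀ θ

end Couplings

/-! ### Functions with point interactions -/

/-- `f` is (locally) absolutely continuous in `s`: absolutely continuous on every compact
interval contained in `s`. -/
def LocallyAC (f : ℝ → ℂ) (s : Set ℝ) : Prop :=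
  ∀ c d : ℝ, c ≤ d → Icc c d ⊆ s → AbsolutelyContinuousOnInterval f c d

/-- The one-sided limits of `f` and `f'` at `p` exist and satisfy
`(f(p+), f'(p+)) = A (f(p-), f'(p-))`. -/
def JumpCondition (A : Matrix (Fin 2) (Fin 2) ℝ) (p : ℝ) (f : ℝ → ℂ) : Prop :=
  ∃ l : Fin 2 → ℂ,
    Tendsto (fun t => ![f t, deriv f t]) (𝓝[<] p) (𝓝 l) ∧
    Tendsto (fun t => ![f t, deriv f t]) (𝓝[>] p)
      (𝓝 ((A.map (fun y : ℝ => (y : ℂ))).mulVec l))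

/-- On `(a, b)`, `f` and `f'` are absolutely continuous away from the interaction points, and `f`
satisfies the jump conditions at all interaction points in `(a, b)`. -/
def Connected {I : Set ℤ} (a b : EReal) (x : I → ℝ) (κ : Couplings I) (f : ℝ → ℂ) : Prop :=
  LocallyAC f (interval a b \ range x) ∧
  LocallyAC (deriv f) (interval a b \ range x) ∧
  ∀ n : I, x n ∈ interval a b → JumpCondition (κ.matrix n) (x n) f

/-- The differential expression `τ f = -f'' + V f`. -/
def tau (V : ℝ → ℝ) (f : ℝ → ℂ) : ℝ → ℂ :=
  fun t => -deriv (deriv f) t + (V t : ℂ) * f t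

/-- `f` is a solution of `(τ_{Λ,R,Θ} - z) f = 0` on `(a, b)`. -/
def IsSolution {I : Set ℤ} (a b : EReal) (V : ℝ → ℝ) (x : I → ℝ) (κ : Couplings I) (z : ℂ)
    (f : ℝ → ℂ) : Prop :=
  Connected a b x κ f ∧
  ∀ᵐ t ∂(volume.restrict (interval a b)), tau V f t - z * f t = 0

/-- `v` is a non-trivial real solution of `(τ_{Λ,R,Θ} - lam) v = 0` near `a`. -/
def IsRealSolutionNearLeft {I : Set ℤ} (a b : EReal) (V : ℝ → ℝ) (x : I → ℝ) (κ : Couplings I)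
    (lam : ℝ) (v : ℝ → ℝ) : Prop :=
  ∃ c : ℝ, c ∈ interval a b ∧
    IsSolution a c V x κ (lam : ℂ) (fun t => (v t : ℂ)) ∧
    ∃ t ∈ interval a c \ range x, v t ≠ 0

/-- `w` is a non-trivial real solution of `(τ_{Λ,R,Θ} - lam) w = 0` near `b`. -/
def IsRealSolutionNearRight {I : Set ℤ} (a b : EReal) (V : ℝ → ℝ) (x : I → ℝ) (κ : Couplings I)
    (lam : ℝ) (w : ℝ → ℝ) : Prop :=
  ∃ c : ℝ, c ∈ interval a b ∧
    IsSolution c b V x κ (lam : ℂ) (fun t => (w t : ℂ)) ∧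
    ∃ t ∈ interval c b \ range x, w t ≠ 0

/-! ### Limit circle case -/

/-- `f` lies left in `L²(a, b)`: it is square integrable in a neighbourhood of `a`. -/
def LiesLeft (a b : EReal) (f : ℝ → ℂ) : Prop :=
  ∃ c : ℝ, c ∈ interval a b ∧ MemLp f 2 (volume.restrict (interval a c))

/-- `f` lies right in `L²(a, b)`: it is square integrable in a neighbourhood of `b`. -/
def LiesRight (a b : EReal) (f : ℝ → ℂ) : Prop :=
  ∃ c : ℝ, c ∈ interval a b ∧ MemLp f 2 (volume.restrict (interval c b))

/-- Limit circle case at `a`. -/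
def LimitCircleLeft {I : Set ℤ} (a b : EReal) (V : ℝ → ℝ) (x : I → ℝ) (κ : Couplings I) : Prop :=
  ∀ (z : ℂ) (f : ℝ → ℂ), IsSolution a b V x κ z f → LiesLeft a b f

/-- Limit circle case at `b`. -/
def LimitCircleRight {I : Set ℤ} (a b : EReal) (V : ℝ → ℝ) (x : I → ℝ) (κ : Couplings I) : Prop :=
  ∀ (z : ℂ) (f : ℝ → ℂ), IsSolution a b V x κ z f → LiesRight a b f

/-! ### The operators -/

/-- The Lagrange bracket `[f, g]_t = conj (f(t+)) g'(t+) - conj (f'(t+)) g(t+)`. -/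
def lagrangeBracket (f g : ℝ → ℂ) (t : ℝ) : ℂ :=
  starRingEnd ℂ (Function.rightLim f t) * Function.rightLim (deriv g) t -
    starRingEnd ℂ (Function.rightLim (deriv f) t) * Function.rightLim g t

/-- The domain of the maximal operator `T_{Λ,R,Θ}`. -/
def maximalDomain {I : Set ℤ} (a b : EReal) (V : ℝ → ℝ) (x : I → ℝ) (κ : Couplings I) :
    Set (ℝ → ℂ) :=
  {f | MemLp f 2 (volume.restrict (interval a b)) ∧
    Connected a b x κ f ∧
    MemLp (tau V f) 2 (volume.restrict (interval a b))}

/-- The domain of the selfadjoint restriction `H_{Λ,R,Θ}` of the maximal operator: the boundary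
condition `[v, f]_a = 0` is imposed in the limit circle case at `a`, and `[w, f]_b = 0` in the
limit circle case at `b`. On this domain `H_{Λ,R,Θ} f = τ f`. -/
def operatorDomain {I : Set ℤ} (a b : EReal) (V : ℝ → ℝ) (x : I → ℝ) (v w : ℝ → ℝ)
    (κ : Couplings I) : Set (ℝ → ℂ) :=
  {f | f ∈ maximalDomain a b V x κ ∧
    (LimitCircleLeft a b V x κ →
      Tendsto (lagrangeBracket (fun t => (v t : ℂ)) f)
        (comap (fun t : ℝ => (t : EReal)) (𝓝[>] a)) (𝓝 0)) ∧
    (LimitCircleRight a b V x κ →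
      Tendsto (lagrangeBracket (fun t => (w t : ℂ)) f)
        (comap (fun t : ℝ => (t : EReal)) (𝓝[<] b)) (𝓝 0))}

/-- The set `σ_p(H_{Λ,R,Θ})` of eigenvalues: there is an element `f` of the domain, non-zero in
`L²(a, b)`, with `H f = z f` in `L²(a, b)`. -/
def pointSpectrum {I : Set ℤ} (a b : EReal) (V : ℝ → ℝ) (x : I → ℝ) (v w : ℝ → ℝ)
    (κ : Couplings I) : Set ℂ :=
  {z | ∃ f ∈ operatorDomain a b V x v w κ,
    ¬ (∀ᵐ t ∂(volume.restrict (interval a b)), f t = 0) ∧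
    ∀ᵐ t ∂(volume.restrict (interval a b)), tau V f t = z * f t}

/-- The set `P(E)` of all `(α, r, θ) ∈ ℝ × (0, ∞) × ℝ` such that `E` is an eigenvalue of the
operator in which the interaction `n₀` has the parameters `α, r, θ`. -/
def parameterSet {I : Set ℤ} (a b : EReal) (V : ℝ → ℝ) (x : I → ℝ) (v w : ℝ → ℝ)
    (κ : Couplings I) (n₀ : I) (E : ℝ) : Set (ℝ × ℝ × ℝ) :=
  {p | 0 < p.2.1 ∧
    (E : ℂ) ∈ pointSpectrum a b V x v w (κ.replaceAt n₀ p.1 p.2.1 p.2.2)}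

end PointInteraction

end

/-!
The jet `(f, f')` of a solution jumps at the interaction points by matrices in `SL(2, ℝ)`, which
preserve the Wronskian; hence the equation with interactions has the existence, uniqueness and
Wronskian theory of a regular Sturm–Liouville equation, and Weyl's alternative holds at both end
points. Consequently the boundary values at `x n₀` of the solutions on the left which are square
integrable near `a` and satisfy the boundary condition there are either zero or the complex
multiples of one real vector `u`; likewise on the right, with a real vector `m`. Neither vector
depends on the parameters at `n₀`, and `E` is an eigenvalue exactly when `A_{α,r,θ}` maps the line
of `u` to that of `m`. Multiplied by `r`, this condition is

`(m₀ - α m₁) (u₀ sin θ + u₁ cos θ) - r² m₁ (u₀ cos θ - u₁ sin θ) = 0`,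

a sinusoid in `θ`, affine in `r²` and affine in `α`.
-/

noncomputable section

namespace PointInteraction

/-! ### The symplectic form on the plane -/

section Wedge

variable {R : Type*} [CommRing R]

/-- The standard symplectic form on the plane; the Wronskian and the Lagrange bracket are its values
on jets. -/
def wedge (y y' : Fin 2 → R) : R := y 0 * y' 1 - y 1 * y' 0

theorem wedge_self (y : Fin 2 → R) : wedge y y = 0 := by
  simp only [wedge]; ring

theorem wedge_swap (y y' : Fin 2 → R) : wedge y y' = -wedge y' y := by
  simp only [wedge]; ring

theorem wedge_smul_right (c : R) (y y' : Fin 2 → R) : wedge y (c • y') = c * wedge y y' := by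
  simp only [wedge, Pi.smul_apply, smul_eq_mul]; ring

theorem wedge_mulVec (B : Matrix (Fin 2) (Fin 2) R) (y y' : Fin 2 → R) :
    wedge (B.mulVec y) (B.mulVec y') = B.det * wedge y y' := by
  simp only [wedge, Matrix.mulVec, dotProduct, Fin.sum_univ_two, Matrix.det_fin_two]; ring

theorem wedge_map {S : Type*} [CommRing S] (φ : R →+* S) (y y' : Fin 2 → R) :
    wedge (φ ∘ y) (φ ∘ y') = φ (wedge y y') := by
  simp only [wedge, Function.comp_apply, map_sub, map_mul]

theorem wedge_smul_eq_sub (u₁ u₂ y : Fin 2 → R) :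
    wedge u₁ u₂ • y = wedge y u₂ • u₁ - wedge y u₁ • u₂ := by
  ext i
  fin_cases i <;> simp only [wedge, Fin.zero_eta, Fin.mk_one, Pi.smul_apply, Pi.sub_apply,
    smul_eq_mul] <;> ring

theorem eq_of_forall_wedge_eq {y y' : Fin 2 → R} (h : ∀ e, wedge y e = wedge y' e) : y = y' := by
  ext i
  fin_cases i
  · simpa [wedge] using h ![0, 1]
  · simpa [wedge] using h ![1, 0]

theorem wedge_eq_zero_iff {K : Type*} [Field K] {y y' : Fin 2 → K} (hy : y ≠ 0) :
    wedge y y' = 0 ↔ ∃ c : K, y' = c • y := by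
  refine ⟨fun h => ?_, fun ⟨c, hc⟩ => by rw [hc, wedge_smul_right, wedge_self, mul_zero]⟩
  obtain ⟨e, he⟩ : ∃ e, wedge y e ≠ 0 := by
    contrapose! hy
    exact eq_of_forall_wedge_eq fun e => by rw [hy e]; simp [wedge]
  have hexp := wedge_smul_eq_sub y e y'
  rw [wedge_swap y' y, h, neg_zero, zero_smul, sub_zero] at hexp
  exact ⟨(wedge y e)⁻¹ * wedge y' e, by rw [mul_smul, ← hexp, inv_smul_smul₀ he]⟩

theorem tendsto_wedge {α : Type*} [TopologicalSpace R] [IsTopologicalRing R] {l : Filter α}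
    {Y Y' : α → Fin 2 → R} {y y' : Fin 2 → R} (h : Tendsto Y l (𝓝 y)) (h' : Tendsto Y' l (𝓝 y')) :
    Tendsto (fun t => wedge (Y t) (Y' t)) l (𝓝 (wedge y y')) := by
  rw [tendsto_pi_nhds] at h h'
  exact ((h 0).mul (h' 1)).sub ((h 1).mul (h' 0))

theorem wedge_mulVec_of_det_eq_one {A : Matrix (Fin 2) (Fin 2) ℝ} (hA : A.det = 1)
    (y y' : Fin 2 → ℂ) :
    wedge ((A.map Complex.ofReal).mulVec y) ((A.map Complex.ofReal).mulVec y') = wedge y y' := by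
  have hdet : (A.map Complex.ofReal).det = 1 := by
    have h := RingHom.map_det Complex.ofRealHom A
    rw [hA, map_one] at h
    exact h.symm
  rw [wedge_mulVec, hdet, one_mul]

end Wedge

/-! ### Jets and solutions -/

section Solutions

/-- The first jet `(f, f')`, the vector on which an interaction matrix acts. -/
def jet (f : ℝ → ℂ) (t : ℝ) : Fin 2 → ℂ := ![f t, deriv f t]

/-- The bilinear Wronskian `f h' - f' h`. -/
def wronskian (f h : ℝ → ℂ) (t : ℝ) : ℂ := wedge (jet f t) (jet h t)

/-- `f` solves `-f'' + V f = z f` at `q`, where `Q` is a primitive of the potential `V`: written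
with the quasi-derivative `f' - Q f`, the equation makes sense at every point although `V` is only
integrable. -/
def SolvesODEAt (Q : ℝ → ℝ) (z : ℂ) (f : ℝ → ℂ) (q : ℝ) : Prop :=
  DifferentiableAt ℝ f q ∧
    HasDerivAt (fun t => deriv f t - Q t * f t) (-z * f q - Q q * deriv f q) q

variable {ι : Type*}

/-- `f` solves the equation at `q`, or satisfies the jump condition there if `q` is an interaction
point. -/
def SolvesAt (Q : ℝ → ℝ) (x : ι → ℝ) (A : ι → Matrix (Fin 2) (Fin 2) ℝ) (z : ℂ) (f : ℝ → ℂ)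
    (q : ℝ) : Prop :=
  (q ∉ range x → SolvesODEAt Q z f q) ∧ ∀ n, x n = q → JumpCondition (A n) q f

/-- `f` is a solution on `J` of the equation with point interactions `A n` at `x n`. -/
def SolvesOn (J : Set ℝ) (Q : ℝ → ℝ) (x : ι → ℝ) (A : ι → Matrix (Fin 2) (Fin 2) ℝ) (z : ℂ)
    (f : ℝ → ℂ) : Prop :=
  ∀ q ∈ J, SolvesAt Q x A z f q

/-- Standing assumptions under which the equation with point interactions behaves like a regular
Sturm–Liouville equation on the open interval `J`. -/
structure Regular (J : Set ℝ) (Q : ℝ → ℝ) (x : ι → ℝ) (A : ι → Matrix (Fin 2) (Fin 2) ℝ) :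
    Prop where
  isOpen : IsOpen J
  ordConnected : J.OrdConnected
  discrete : ∀ q ∈ J, ∀ᶠ t in 𝓝[≠] q, t ∉ range x
  continuousOn : ContinuousOn Q J
  det : ∀ n, (A n).det = 1
  injective : Function.Injective x

variable {J J' U N : Set ℝ} {Q : ℝ → ℝ} {x : ι → ℝ} {A A' : ι → Matrix (Fin 2) (Fin 2) ℝ}
  {z z₁ z₂ : ℂ} {f g h : ℝ → ℂ} {q s t : ℝ}

namespace Regular

theorem mono (hR : Regular J Q x A) (hJ' : IsOpen J') (ho : J'.OrdConnected) (hs : J' ⊆ J) :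
    Regular J' Q x A where
  isOpen := hJ'
  ordConnected := ho
  discrete q hq := hR.discrete q (hs hq)
  continuousOn := hR.continuousOn.mono hs
  det := hR.det
  injective := hR.injective

theorem inter (hU : Regular U Q x A) (hN : Regular N Q x A) : Regular (U ∩ N) Q x A :=
  hU.mono (hU.isOpen.inter hN.isOpen) (hU.ordConnected.inter hN.ordConnected) inter_subset_left

theorem inter_Iio (hR : Regular J Q x A) (q : ℝ) : Regular (J ∩ Iio q) Q x A :=
  hR.mono (hR.isOpen.inter isOpen_Iio) (hR.ordConnected.inter ordConnected_Iio) inter_subset_left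

theorem inter_Ioi (hR : Regular J Q x A) (q : ℝ) : Regular (J ∩ Ioi q) Q x A :=
  hR.mono (hR.isOpen.inter isOpen_Ioi) (hR.ordConnected.inter ordConnected_Ioi) inter_subset_left

theorem union (hU : Regular U Q x A) (hN : Regular N Q x A) (hne : (U ∩ N).Nonempty) :
    Regular (U ∪ N) Q x A where
  isOpen := hU.isOpen.union hN.isOpen
  ordConnected := isPreconnected_iff_ordConnected.1
    (hU.ordConnected.isPreconnected.union' hne hN.ordConnected.isPreconnected)
  discrete q hq := hq.elim (hU.discrete q) (hN.discrete q)
  continuousOn := hU.continuousOn.union_of_isOpen hN.continuousOn hU.isOpen hN.isOpen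
  det := hU.det
  injective := hU.injective

theorem eventually_mem_diff (hR : Regular J Q x A) (hq : q ∈ J) :
    ∀ᶠ t in 𝓝[≠] q, t ∈ J \ range x := by
  filter_upwards [hR.discrete q hq, nhdsWithin_le_nhds (hR.isOpen.mem_nhds hq)] with t h₁ h₂
  exact ⟨h₂, h₁⟩

theorem isOpen_diff (hR : Regular J Q x A) : IsOpen (J \ range x) := by
  rw [isOpen_iff_mem_nhds]
  rintro q ⟨hq, hqx⟩
  filter_upwards [eventually_nhdsWithin_iff.1 (hR.eventually_mem_diff hq)] with t ht
  exact (eq_or_ne t q).elim (fun htq => htq ▸ ⟨hq, hqx⟩) ht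

theorem subset_closure_diff (hR : Regular J Q x A) : J ⊆ closure (J \ range x) := fun _ hq =>
  mem_closure_iff_frequently.2
    ((hR.eventually_mem_diff hq).frequently.filter_mono nhdsWithin_le_nhds)

theorem nonempty_diff (hR : Regular J Q x A) (hJ : J.Nonempty) : (J \ range x).Nonempty :=
  closure_nonempty_iff.1 (hJ.mono hR.subset_closure_diff)

theorem continuousAt (hR : Regular J Q x A) (hq : q ∈ J) : ContinuousAt Q q :=
  hR.continuousOn.continuousAt (hR.isOpen.mem_nhds hq)

theorem exists_subset_of_eventually (hR : Regular J Q x A) (hq : q ∈ J) {P : ℝ → Prop}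
    (hP : ∀ᶠ t in 𝓝 q, P t) : ∃ U ⊆ J, Regular U Q x A ∧ q ∈ U ∧ ∀ t ∈ U, P t := by
  obtain ⟨ε, hε, hball⟩ := Metric.eventually_nhds_iff_ball.1 ((hR.isOpen.eventually_mem hq).and hP)
  refine ⟨Metric.ball q ε, fun t ht => (hball t ht).1, ?_, Metric.mem_ball_self hε,
    fun t ht => (hball t ht).2⟩
  exact hR.mono Metric.isOpen_ball (Real.ball_eq_Ioo q ε ▸ ordConnected_Ioo)
    fun t ht => (hball t ht).1

end Regular

theorem jet_eventuallyEq_nhds (hfg : f =ᶠ[𝓝 q] g) : jet f =ᶠ[𝓝 q] jet g := by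
  filter_upwards [hfg, hfg.deriv] with t h₀ h₁ using by rw [jet, jet, h₀, h₁]

theorem jet_eventuallyEq_nhdsNE (hfg : f =ᶠ[𝓝[≠] q] g) : jet f =ᶠ[𝓝[≠] q] jet g := by
  filter_upwards [hfg, hfg.nhdsNE_deriv] with t h₀ h₁ using by rw [jet, jet, h₀, h₁]

theorem eqOn_jet (hU : IsOpen U) (hfg : EqOn f g U) : EqOn (jet f) (jet g) U := fun _ ht =>
  (jet_eventuallyEq_nhds (hfg.eventuallyEq_of_mem (hU.mem_nhds ht))).eq_of_nhds

theorem jet_linearCombination (hf : DifferentiableAt ℝ f t) (hg : DifferentiableAt ℝ g t)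
    (c d : ℂ) : jet (c • f + d • g) t = c • jet f t + d • jet g t := by
  have hderiv : deriv (c • f + d • g) t = c * deriv f t + d * deriv g t :=
    ((hf.hasDerivAt.const_mul c).add (hg.hasDerivAt.const_mul d)).deriv
  ext i
  fin_cases i
  · rfl
  · exact hderiv

theorem JumpCondition.congr {B : Matrix (Fin 2) (Fin 2) ℝ} (hf : JumpCondition B q f)
    (hfg : f =ᶠ[𝓝[≠] q] g) : JumpCondition B q g := by
  obtain ⟨l, hl, hr⟩ := hf
  have hjet := jet_eventuallyEq_nhdsNE hfg
  exact ⟨l, hl.congr' (hjet.filter_mono (nhdsLT_le_nhdsNE q)),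
    hr.congr' (hjet.filter_mono (nhdsGT_le_nhdsNE q))⟩

theorem SolvesODEAt.congr (hf : SolvesODEAt Q z f q) (hfg : f =ᶠ[𝓝 q] g) :
    SolvesODEAt Q z g q := by
  refine ⟨hf.1.congr_of_eventuallyEq hfg.symm, ?_⟩
  rw [← hfg.eq_of_nhds, ← hfg.deriv.eq_of_nhds]
  refine hf.2.congr_of_eventuallyEq ?_
  filter_upwards [hfg, hfg.deriv] with t h₀ h₁ using by rw [h₀, h₁]

theorem SolvesODEAt.continuousAt_jet (hf : SolvesODEAt Q z f q) (hQ : ContinuousAt Q q) :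
    ContinuousAt (jet f) q := by
  have hQf : ContinuousAt (fun t => (Q t : ℂ) * f t) q :=
    (Complex.continuous_ofReal.continuousAt.comp hQ).mul hf.1.continuousAt
  have hderiv : ContinuousAt (deriv f) q :=
    (hf.2.continuousAt.add hQf).congr (Eventually.of_forall fun t => by simp)
  refine continuousAt_pi.2 fun i => ?_
  fin_cases i
  exacts [hf.1.continuousAt, hderiv]

theorem SolvesAt.congr (hf : SolvesAt Q x A z f q) (hfg : f =ᶠ[𝓝[≠] q] g)
    (hq : q ∉ range x → f q = g q) : SolvesAt Q x A z g q :=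
  ⟨fun hqx => (hf.1 hqx).congr (eventuallyEq_nhds_of_eventuallyEq_nhdsNE hfg (hq hqx)),
    fun n hn => (hf.2 n hn).congr hfg⟩

namespace SolvesOn

theorem mono (hf : SolvesOn J Q x A z f) (hs : J' ⊆ J) : SolvesOn J' Q x A z f :=
  fun q hq => hf q (hs hq)

theorem congr (hR : Regular J Q x A) (hf : SolvesOn J Q x A z f)
    (hfg : EqOn f g (J \ range x)) : SolvesOn J Q x A z g := fun q hq =>
  (hf q hq).congr ((hR.eventually_mem_diff hq).mono hfg) fun hqx => hfg ⟨hq, hqx⟩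

theorem congr_matrix (hf : SolvesOn J Q x A z f) (hA : ∀ n, x n ∈ J → A n = A' n) :
    SolvesOn J Q x A' z f := fun q hq =>
  ⟨(hf q hq).1, fun n hn => hA n (hn ▸ hq) ▸ (hf q hq).2 n hn⟩

theorem hasDerivAt (hf : SolvesOn J Q x A z f) (hq : q ∈ J \ range x) :
    HasDerivAt f (deriv f q) q :=
  ((hf q hq.1).1 hq.2).1.hasDerivAt

theorem hasDerivAt_quasiDeriv (hf : SolvesOn J Q x A z f) (hq : q ∈ J \ range x) :
    HasDerivAt (fun t => deriv f t - Q t * f t) (-z * f q - Q q * deriv f q) q :=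
  ((hf q hq.1).1 hq.2).2

theorem continuousAt_jet (hR : Regular J Q x A) (hf : SolvesOn J Q x A z f)
    (hq : q ∈ J \ range x) : ContinuousAt (jet f) q :=
  ((hf q hq.1).1 hq.2).continuousAt_jet (hR.continuousAt hq.1)

theorem continuousOn (hf : SolvesOn J Q x A z f) : ContinuousOn f (J \ range x) :=
  fun _ hq => (hf.hasDerivAt hq).continuousAt.continuousWithinAt

theorem continuousOn_deriv (hR : Regular J Q x A) (hf : SolvesOn J Q x A z f) :
    ContinuousOn (deriv f) (J \ range x) := fun _ hq =>
  (continuousAt_pi.1 (hf.continuousAt_jet hR hq) 1).continuousWithinAt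

theorem exists_tendsto_jet_left (hR : Regular J Q x A) (hf : SolvesOn J Q x A z f) (hq : q ∈ J) :
    ∃ y, Tendsto (jet f) (𝓝[<] q) (𝓝 y) := by
  by_cases hqx : q ∈ range x
  · obtain ⟨n, hn⟩ := hqx
    obtain ⟨l, hl, -⟩ := (hf q hq).2 n hn
    exact ⟨l, hl⟩
  · exact ⟨_, (hf.continuousAt_jet hR ⟨hq, hqx⟩).mono_left nhdsWithin_le_nhds⟩

theorem exists_tendsto_jet_right (hR : Regular J Q x A) (hf : SolvesOn J Q x A z f) (hq : q ∈ J) :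
    ∃ y, Tendsto (jet f) (𝓝[>] q) (𝓝 y) := by
  by_cases hqx : q ∈ range x
  · obtain ⟨n, hn⟩ := hqx
    obtain ⟨l, -, hr⟩ := (hf q hq).2 n hn
    exact ⟨_, hr⟩
  · exact ⟨_, (hf.continuousAt_jet hR ⟨hq, hqx⟩).mono_left nhdsWithin_le_nhds⟩

theorem jet_linearCombination (hf : SolvesOn J Q x A z f) (hg : SolvesOn J Q x A z g) (c d : ℂ)
    (hq : q ∈ J \ range x) : jet (c • f + d • g) q = c • jet f q + d • jet g q :=
  PointInteraction.jet_linearCombination (hf.hasDerivAt hq).differentiableAt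
    (hg.hasDerivAt hq).differentiableAt c d

theorem linearCombination (hR : Regular J Q x A) (hf : SolvesOn J Q x A z f)
    (hg : SolvesOn J Q x A z g) (c d : ℂ) : SolvesOn J Q x A z (c • f + d • g) := by
  intro q hq
  have hjet : jet (c • f + d • g) =ᶠ[𝓝[≠] q] fun t => c • jet f t + d • jet g t :=
    (hR.eventually_mem_diff hq).mono fun t => hf.jet_linearCombination hg c d
  refine ⟨fun hqx => ⟨?_, ?_⟩, fun n hn => ?_⟩
  · exact (((hf.hasDerivAt ⟨hq, hqx⟩).const_mul c).add
      ((hg.hasDerivAt ⟨hq, hqx⟩).const_mul d)).differentiableAt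
  · have hderiv : ∀ t ∈ J \ range x, deriv (c • f + d • g) t = c * deriv f t + d * deriv g t :=
      fun t ht => congrFun (hf.jet_linearCombination hg c d ht) 1
    rw [hderiv q ⟨hq, hqx⟩]
    refine ((((hf.hasDerivAt_quasiDeriv ⟨hq, hqx⟩).const_mul c).add
      ((hg.hasDerivAt_quasiDeriv ⟨hq, hqx⟩).const_mul d)).congr_deriv ?_).congr_of_eventuallyEq ?_
    · simp only [Pi.add_apply, Pi.smul_apply, smul_eq_mul]
      ring
    · filter_upwards [hR.isOpen_diff.mem_nhds ⟨hq, hqx⟩] with t ht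
      rw [hderiv t ht]
      simp only [Pi.add_apply, Pi.smul_apply, smul_eq_mul]
      ring
  · obtain ⟨l, hl, hr⟩ := (hf q hq).2 n hn
    obtain ⟨m, ml, mr⟩ := (hg q hq).2 n hn
    have hleft := hjet.filter_mono (nhdsLT_le_nhdsNE q)
    have hright := hjet.filter_mono (nhdsGT_le_nhdsNE q)
    refine ⟨c • l + d • m, ((hl.const_smul c).add (ml.const_smul d)).congr' hleft.symm, ?_⟩
    rw [Matrix.mulVec_add, Matrix.mulVec_smul, Matrix.mulVec_smul]
    exact ((hr.const_smul c).add (mr.const_smul d)).congr' hright.symm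

end SolvesOn

theorem deriv_conj (f : ℝ → ℂ) :
    deriv (fun t => starRingEnd ℂ (f t)) = fun t => starRingEnd ℂ (deriv f t) :=
  funext fun _ => deriv.star

theorem jet_conj (f : ℝ → ℂ) (t : ℝ) :
    jet (fun t => starRingEnd ℂ (f t)) t = starRingEnd ℂ ∘ jet f t := by
  ext i
  fin_cases i
  · rfl
  · exact congrFun (deriv_conj f) t

theorem tendsto_jet_conj {l : Filter ℝ} {y : Fin 2 → ℂ} (hf : Tendsto (jet f) l (𝓝 y)) :
    Tendsto (jet fun t => starRingEnd ℂ (f t)) l (𝓝 (starRingEnd ℂ ∘ y)) := by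
  rw [funext (jet_conj f)]
  exact tendsto_pi_nhds.2 fun i =>
    (Complex.continuous_conj.tendsto _).comp (tendsto_pi_nhds.1 hf i)

theorem SolvesOn.conj (hf : SolvesOn J Q x A z f) :
    SolvesOn J Q x A (starRingEnd ℂ z) (fun t => starRingEnd ℂ (f t)) := by
  refine fun q hq => ⟨fun hqx => ⟨(hf.hasDerivAt ⟨hq, hqx⟩).star.differentiableAt, ?_⟩,
    fun n hn => ?_⟩
  · rw [deriv_conj]
    have hquasi := (hf.hasDerivAt_quasiDeriv ⟨hq, hqx⟩).star
    simpa only [← starRingEnd_apply, map_sub, map_mul, map_neg, Complex.conj_ofReal] using hquasi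
  · obtain ⟨l, hl, hr⟩ := (hf q hq).2 n hn
    refine ⟨starRingEnd ℂ ∘ l, tendsto_jet_conj hl, ?_⟩
    have hreal : (A n).map Complex.ofReal = ((A n).map Complex.ofReal).map (starRingEnd ℂ) := by
      ext i j
      simp only [Matrix.map_apply, Complex.conj_ofReal]
    have hmul : starRingEnd ℂ ∘ ((A n).map Complex.ofReal).mulVec l =
        ((A n).map Complex.ofReal).mulVec (starRingEnd ℂ ∘ l) := by
      ext i
      conv_rhs => rw [hreal]
      exact RingHom.map_mulVec (starRingEnd ℂ) _ l i
    exact hmul ▸ tendsto_jet_conj hr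

/-! ### Gluing solutions -/

theorem SolvesOn.ite_lt (hx : Function.Injective x) {n : ι} {y : Fin 2 → ℂ}
    (hf : SolvesOn (J ∩ Iio (x n)) Q x A z f) (hfy : Tendsto (jet f) (𝓝[<] (x n)) (𝓝 y))
    (hg : SolvesOn (J ∩ Ioi (x n)) Q x A z g)
    (hgy : Tendsto (jet g) (𝓝[>] (x n)) (𝓝 (((A n).map Complex.ofReal).mulVec y))) :
    SolvesOn J Q x A z (fun t => if t < x n then f t else g t) := by
  have hleft : EqOn f (fun t => if t < x n then f t else g t) (Iio (x n)) :=
    fun _ ht => (if_pos ht).symm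
  have hright : EqOn g (fun t => if t < x n then f t else g t) (Ioi (x n)) :=
    fun _ ht => (if_neg (not_lt_of_gt ht)).symm
  intro q hq
  rcases lt_trichotomy q (x n) with hqn | rfl | hqn
  · exact (hf q ⟨hq, hqn⟩).congr
      ((hleft.eventuallyEq_of_mem (Iio_mem_nhds hqn)).filter_mono nhdsWithin_le_nhds)
      fun _ => hleft hqn
  · refine ⟨fun hqx => (hqx ⟨n, rfl⟩).elim, fun m hm => ?_⟩
    obtain rfl := hx hm
    exact ⟨y, hfy.congr' ((eqOn_jet isOpen_Iio hleft).eventuallyEq_of_mem self_mem_nhdsWithin),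
      hgy.congr' ((eqOn_jet isOpen_Ioi hright).eventuallyEq_of_mem self_mem_nhdsWithin)⟩
  · exact (hg q ⟨hq, hqn⟩).congr
      ((hright.eventuallyEq_of_mem (Ioi_mem_nhds hqn)).filter_mono nhdsWithin_le_nhds)
      fun _ => hright hqn

theorem exists_solvesOn_iUnion {σ : Type*} {U : σ → Set ℝ} {F : σ → ℝ → ℂ}
    (hU : ∀ i, Regular (U i) Q x A) (hF : ∀ i, SolvesOn (U i) Q x A z (F i))
    (hcompat : ∀ i j, EqOn (F i) (F j) ((U i ∩ U j) \ range x)) :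
    ∃ f, SolvesOn (⋃ i, U i) Q x A z f ∧ ∀ i, EqOn f (F i) (U i \ range x) := by
  classical
  let f : ℝ → ℂ := fun t => if ht : ∃ i, t ∈ U i then F ht.choose t else 0
  have hf : ∀ i, EqOn f (F i) (U i \ range x) := by
    rintro i t ⟨ht, htx⟩
    have hex : ∃ j, t ∈ U j := ⟨i, ht⟩
    simp only [f, dif_pos hex]
    exact hcompat _ _ ⟨⟨hex.choose_spec, ht⟩, htx⟩
  refine ⟨f, fun q hq => ?_, hf⟩
  obtain ⟨i, hi⟩ := mem_iUnion.1 hq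
  exact (hF i).congr (hU i) (hf i).symm q hi

theorem exists_solvesOn_union (hU : Regular U Q x A) (hN : Regular N Q x A)
    (hf : SolvesOn U Q x A z f) (hg : SolvesOn N Q x A z g)
    (hfg : EqOn f g ((U ∩ N) \ range x)) :
    ∃ h, SolvesOn (U ∪ N) Q x A z h ∧ EqOn h f (U \ range x) := by
  obtain ⟨h, hh, heq⟩ := exists_solvesOn_iUnion (σ := Bool) (U := (cond · U N)) (F := (cond · f g))
    (z := z) (Q := Q) (x := x) (A := A) (Bool.rec hN hU) (Bool.rec hg hf) (by
      rintro (_ | _) (_ | _)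
      exacts [fun _ _ => rfl, fun t ht => (hfg ⟨ht.1.symm, ht.2⟩).symm, hfg, fun _ _ => rfl])
  rw [← union_eq_iUnion] at hh
  exact ⟨h, hh, heq true⟩

/-! ### Green's formula -/

namespace SolvesOn

theorem hasDerivAt_wronskian (hf : SolvesOn J Q x A z₁ f) (hh : SolvesOn J Q x A z₂ h)
    (hq : q ∈ J \ range x) : HasDerivAt (wronskian f h) ((z₁ - z₂) * (f q * h q)) q := by
  have hquasi := ((hf.hasDerivAt hq).mul (hh.hasDerivAt_quasiDeriv hq)).sub
    ((hf.hasDerivAt_quasiDeriv hq).mul (hh.hasDerivAt hq))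
  refine (hquasi.congr_deriv (by ring)).congr_of_eventuallyEq (Eventually.of_forall fun t => ?_)
  simp only [wronskian, wedge, jet, Matrix.cons_val_zero, Matrix.cons_val_one, Pi.sub_apply,
    Pi.mul_apply]
  ring

theorem exists_tendsto_wronskian (hR : Regular J Q x A) (hf : SolvesOn J Q x A z₁ f)
    (hh : SolvesOn J Q x A z₂ h) (hq : q ∈ J) : ∃ L, Tendsto (wronskian f h) (𝓝[≠] q) (𝓝 L) := by
  by_cases hqx : q ∈ range x
  · obtain ⟨n, hn⟩ := hqx
    obtain ⟨l, hl, hr⟩ := (hf q hq).2 n hn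
    obtain ⟨m, ml, mr⟩ := (hh q hq).2 n hn
    refine ⟨wedge l m, ?_⟩
    rw [← nhdsLT_sup_nhdsGT, tendsto_sup]
    refine ⟨tendsto_wedge hl ml, ?_⟩
    rw [← wedge_mulVec_of_det_eq_one (hR.det n)]
    exact tendsto_wedge hr mr
  · exact ⟨_, (hf.hasDerivAt_wronskian hh ⟨hq, hqx⟩).continuousAt.mono_left nhdsWithin_le_nhds⟩

end SolvesOn

section Countable

variable [Countable ι]

theorem ae_notMem_range (x : ι → ℝ) {μ : Measure ℝ} (hμ : μ ≪ volume) : ∀ᵐ t ∂μ, t ∉ range x :=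
  hμ.ae_le ((countable_range x).ae_notMem volume)

theorem diff_range_ae_eq (x : ι → ℝ) (J : Set ℝ) : (J \ range x : Set ℝ) =ᵐ[volume] J :=
  sdiff_null_ae_eq_self ((countable_range x).measure_zero volume)

namespace SolvesOn

theorem aestronglyMeasurable (hR : Regular J Q x A) (hf : SolvesOn J Q x A z f) :
    AEStronglyMeasurable f (volume.restrict J) := by
  rw [← Measure.restrict_congr_set (diff_range_ae_eq x J)]
  exact hf.continuousOn.aestronglyMeasurable hR.isOpen_diff.measurableSet

theorem locallyIntegrableOn_mul (hR : Regular J Q x A) (hf : SolvesOn J Q x A z₁ f)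
    (hh : SolvesOn J Q x A z₂ h) : LocallyIntegrableOn (fun t => f t * h t) J := by
  intro q hq
  rw [hR.isOpen.nhdsWithin_eq hq]
  have hone_sided : ∀ l ≤ 𝓝 q, l.IsMeasurablyGenerated → (∃ y, Tendsto (jet f) l (𝓝 y)) →
      (∃ y, Tendsto (jet h) l (𝓝 y)) → IntegrableAtFilter (fun t => f t * h t) l := by
    rintro l hl _ ⟨y, hy⟩ ⟨y', hy'⟩
    exact ((tendsto_pi_nhds.1 hy 0).mul (tendsto_pi_nhds.1 hy' 0)).integrableAtFilter
      ⟨J, hl (hR.isOpen.mem_nhds hq), (hf.aestronglyMeasurable hR).mul (hh.aestronglyMeasurable hR)⟩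
      ((volume.finiteAt_nhds q).filter_mono hl)
  obtain ⟨S, hS, hSi⟩ := IntegrableAtFilter.sup_iff.2
    ⟨hone_sided (𝓝[<] q) nhdsWithin_le_nhds inferInstance (hf.exists_tendsto_jet_left hR hq)
      (hh.exists_tendsto_jet_left hR hq),
    hone_sided (𝓝[>] q) nhdsWithin_le_nhds inferInstance (hf.exists_tendsto_jet_right hR hq)
      (hh.exists_tendsto_jet_right hR hq)⟩
  rw [nhdsLT_sup_nhdsGT] at hS
  exact ⟨insert q S, insert_mem_nhds_iff.2 hS, hSi.congr_set_ae (insert_ae_eq_self q S)⟩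

theorem intervalIntegrable_mul (hR : Regular J Q x A) (hf : SolvesOn J Q x A z₁ f)
    (hh : SolvesOn J Q x A z₂ h) (hs : s ∈ J) (ht : t ∈ J) :
    IntervalIntegrable (fun r => f r * h r) volume s t :=
  ((hf.locallyIntegrableOn_mul hR hh).integrableOn_compact_subset
    (hR.ordConnected.uIcc_subset hs ht) isCompact_uIcc).intervalIntegrable

/-- Green's formula. Since unimodular jumps preserve `wedge`, the Wronskian extends continuously
across the interaction points. -/
theorem wronskian_sub (hR : Regular J Q x A) (hf : SolvesOn J Q x A z₁ f)
    (hh : SolvesOn J Q x A z₂ h) (hs : s ∈ J \ range x) (ht : t ∈ J \ range x) :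
    wronskian f h t - wronskian f h s = (z₁ - z₂) * ∫ r in s..t, f r * h r := by
  set W := extendFrom (J \ range x) (wronskian f h)
  have hW : ContinuousOn W J := by
    refine continuousOn_extendFrom hR.subset_closure_diff fun q hq => ?_
    by_cases hqx : q ∈ range x
    · obtain ⟨L, hL⟩ := hf.exists_tendsto_wronskian hR hh hq
      exact ⟨L, hL.mono_left (nhdsWithin_mono _ fun t ht htq => ht.2 (htq ▸ hqx))⟩
    · exact ⟨_, (hf.hasDerivAt_wronskian hh ⟨hq, hqx⟩).continuousAt.mono_left nhdsWithin_le_nhds⟩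
  have hWeq : EqOn W (wronskian f h) (J \ range x) := extendFrom_extends
    fun q hq => (hf.hasDerivAt_wronskian hh hq).continuousAt.continuousWithinAt
  have hsub := hR.ordConnected.uIcc_subset hs.1 ht.1
  rw [← hWeq ht, ← hWeq hs, ← intervalIntegral.integral_const_mul]
  refine (integral_eq_of_hasDerivAt_off_countable W _ (countable_range x) (hW.mono hsub)
    (fun q hq => ?_) ((hf.intervalIntegrable_mul hR hh hs.1 ht.1).const_mul _)).symm
  have hqJ : q ∈ J \ range x := ⟨hsub (Ioo_subset_Icc_self hq.1), hq.2⟩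
  exact (hf.hasDerivAt_wronskian hh hqJ).congr_of_eventuallyEq
    (hWeq.eventuallyEq_of_mem (hR.isOpen_diff.mem_nhds hqJ))

theorem wronskian_eq (hR : Regular J Q x A) (hf : SolvesOn J Q x A z f)
    (hh : SolvesOn J Q x A z h) (hs : s ∈ J \ range x) (ht : t ∈ J \ range x) :
    wronskian f h t = wronskian f h s := by
  rw [← sub_eq_zero, hf.wronskian_sub hR hh hs ht, sub_self, zero_mul]

end SolvesOn

end Countable

/-! ### Initial value problems -/

/-- Every initial value problem posed at a point of `U` off the interaction points has a solution on
all of `U`. -/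
def SolvableOn (U : Set ℝ) (Q : ℝ → ℝ) (x : ι → ℝ) (A : ι → Matrix (Fin 2) (Fin 2) ℝ) (z : ℂ) :
    Prop :=
  ∀ s ∈ U \ range x, ∀ y, ∃ f, SolvesOn U Q x A z f ∧ jet f s = y

theorem SolvableOn.mono (hU : SolvableOn U Q x A z) (hN : N ⊆ U) : SolvableOn N Q x A z :=
  fun s hs y => (hU s ⟨hN hs.1, hs.2⟩ y).imp fun _ hf => ⟨hf.1.mono hN, hf.2⟩

section Countable

variable [Countable ι]

theorem SolvableOn.eqOn_jet (hR : Regular U Q x A) (hU : SolvableOn U Q x A z)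
    (hf : SolvesOn U Q x A z f) (hg : SolvesOn U Q x A z g) (hs : s ∈ U \ range x)
    (hfg : jet f s = jet g s) : EqOn (jet f) (jet g) (U \ range x) := by
  refine fun t ht => eq_of_forall_wedge_eq fun e => ?_
  obtain ⟨k, hk, rfl⟩ := hU t ht e
  calc wronskian f k t = wronskian f k s := hf.wronskian_eq hR hk hs ht
    _ = wronskian g k s := by rw [wronskian, wronskian, hfg]
    _ = wronskian g k t := (hg.wronskian_eq hR hk hs ht).symm

theorem SolvableOn.eqOn (hR : Regular U Q x A) (hU : SolvableOn U Q x A z)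
    (hf : SolvesOn U Q x A z f) (hg : SolvesOn U Q x A z g) (hs : s ∈ U \ range x)
    (hfg : jet f s = jet g s) : EqOn f g (U \ range x) :=
  fun _ ht => congrFun (hU.eqOn_jet hR hf hg hs hfg ht) 0

theorem solvableOn_of_wronskian_ne_zero (hR : Regular U Q x A) (hf : SolvesOn U Q x A z f)
    (hg : SolvesOn U Q x A z g) (hs : s ∈ U \ range x) (hW : wronskian f g s ≠ 0) :
    SolvableOn U Q x A z := by
  intro t ht y
  have hWt : wedge (jet f t) (jet g t) ≠ 0 := by
    rw [← hf.wronskian_eq hR hg hs ht] at hW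
    exact hW
  refine ⟨_, hf.linearCombination hR hg ((wedge (jet f t) (jet g t))⁻¹ * wedge y (jet g t))
    (-((wedge (jet f t) (jet g t))⁻¹ * wedge y (jet f t))), ?_⟩
  rw [hf.jet_linearCombination hg _ _ ht, neg_smul, mul_smul, mul_smul, ← sub_eq_add_neg,
    ← smul_sub, ← wedge_smul_eq_sub, inv_smul_smul₀ hWt]

theorem SolvableOn.exists_extension (hU : Regular U Q x A) (hN : Regular N Q x A)
    (hne : (U ∩ N).Nonempty) (hsolv : SolvableOn N Q x A z) (hf : SolvesOn U Q x A z f) :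
    ∃ g, SolvesOn (U ∪ N) Q x A z g ∧ EqOn g f (U \ range x) := by
  obtain ⟨s, hs⟩ := (hU.inter hN).nonempty_diff hne
  obtain ⟨k, hk, hks⟩ := hsolv s ⟨hs.1.2, hs.2⟩ (jet f s)
  have hfk := (hsolv.mono inter_subset_right).eqOn (hU.inter hN) (hf.mono inter_subset_left)
    (hk.mono inter_subset_right) hs hks.symm
  exact exists_solvesOn_union hU hN hf hk hfk

theorem SolvableOn.union (hU : Regular U Q x A) (hN : Regular N Q x A) (hne : (U ∩ N).Nonempty)
    (hsU : SolvableOn U Q x A z) (hsN : SolvableOn N Q x A z) : SolvableOn (U ∪ N) Q x A z := by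
  obtain ⟨s, hs⟩ := (hU.inter hN).nonempty_diff hne
  have hdata : ∀ y, ∃ g, SolvesOn (U ∪ N) Q x A z g ∧ jet g s = y := by
    intro y
    obtain ⟨f, hf, rfl⟩ := hsU s ⟨hs.1.1, hs.2⟩ y
    obtain ⟨g, hg, hgf⟩ := hsN.exists_extension hU hN hne hf
    exact ⟨g, hg, PointInteraction.eqOn_jet hU.isOpen_diff hgf ⟨hs.1.1, hs.2⟩⟩
  obtain ⟨g₁, hg₁, hj₁⟩ := hdata ![1, 0]
  obtain ⟨g₂, hg₂, hj₂⟩ := hdata ![0, 1]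
  exact solvableOn_of_wronskian_ne_zero (hU.union hN hne) hg₁ hg₂ ⟨.inl hs.1.1, hs.2⟩
    (by simp [wronskian, wedge, hj₁, hj₂])

end Countable

/-! ### Existence of solutions -/

theorem exists_hasDerivAt_clm_apply {𝕜 E : Type*} [NontriviallyNormedField 𝕜]
    [NormedAddCommGroup E] [NormedSpace 𝕜 E] [NormedSpace ℝ E] [CompleteSpace E]
    {L : ℝ → E →L[𝕜] E} {q : ℝ} (hL : ∀ᶠ t in 𝓝 q, ContinuousAt L t) (y : E) :
    ∃ Y : ℝ → E, Y q = y ∧ ∀ᶠ t in 𝓝 q, HasDerivAt Y (L t (Y t)) t := by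
  set K : NNReal := ‖L q‖₊ + 1
  set C : NNReal := K * (‖y‖₊ + 1)
  have hLK : ∀ᶠ t in 𝓝 q, ‖L t‖₊ < K :=
    hL.self_of_nhds.nnnorm.eventually_lt_const (lt_add_one _)
  obtain ⟨δ, hδ, hball⟩ := Metric.nhds_basis_closedBall.eventually_iff.1 (hL.and hLK)
  set ε : ℝ := min δ (1 / (C + 1))
  have hε : 0 < ε := lt_min hδ (by positivity)
  have hCε : C * ε ≤ 1 := by
    calc C * ε ≤ C * (1 / (C + 1)) := by gcongr; exact min_le_right _ _
      _ ≤ 1 := by rw [mul_one_div, div_le_one (by positivity)]; linarith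
  have hIcc : ∀ t ∈ Icc (q - ε) (q + ε), ContinuousAt L t ∧ ‖L t‖₊ < K := fun t ht =>
    hball (by
      rw [Real.closedBall_eq_Icc]
      exact Icc_subset_Icc (by gcongr; exact min_le_left _ _) (by gcongr; exact min_le_left _ _) ht)
  have hPL : IsPicardLindelof (fun t Y => L t Y) (tmin := q - ε) (tmax := q + ε)
      ⟨q, by linarith, by linarith⟩ y 1 0 C K := by
    refine ⟨fun t ht => ((L t).lipschitz.weaken (hIcc t ht).2.le).lipschitzOnWith,
      fun Y _ t ht => ((hIcc t ht).1.clm_apply continuousAt_const).continuousWithinAt,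
      fun t ht Y hY => ?_, ?_⟩
    · have hYnorm : ‖Y‖ ≤ ‖y‖ + 1 :=
        (norm_le_norm_add_norm_sub' Y y).trans (by gcongr; simpa [dist_eq_norm] using hY)
      exact (L t).le_of_opNorm_le_of_le (hIcc t ht).2.le hYnorm
    · simpa using hCε
  obtain ⟨Y, hYq, hY⟩ := hPL.exists_eq_forall_mem_Icc_hasDerivWithinAt₀
  refine ⟨Y, hYq, ?_⟩
  filter_upwards [Ioo_mem_nhds (sub_lt_self q hε) (lt_add_of_pos_right q hε)] with t ht
  exact (hY t (Ioo_subset_Icc_self ht)).hasDerivAt (Icc_mem_nhds ht.1 ht.2)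

/-- The coefficient matrix of the first order system for `f` and its quasi-derivative. -/
def systemMatrix (Q : ℝ → ℝ) (z : ℂ) (t : ℝ) : Matrix (Fin 2) (Fin 2) ℂ :=
  !![Q t, 1; -z - Q t ^ 2, -Q t]

theorem continuousAt_systemMatrix (hQ : ContinuousAt Q t) (z : ℂ) :
    ContinuousAt (systemMatrix Q z) t := by
  have hQ' : ContinuousAt (fun t => (Q t : ℂ)) t := Complex.continuous_ofReal.continuousAt.comp hQ
  refine continuousAt_pi.2 fun i => continuousAt_pi.2 fun j => ?_
  fin_cases i <;> fin_cases j
  exacts [hQ', continuousAt_const, continuousAt_const.sub (hQ'.pow 2), hQ'.neg]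

theorem exists_solvesODEAt (hQ : ∀ᶠ t in 𝓝 q, ContinuousAt Q t) (z : ℂ) (y : Fin 2 → ℂ) :
    ∃ f, jet f q = y ∧ ∀ᶠ t in 𝓝 q, SolvesODEAt Q z f t := by
  let toCLM : Matrix (Fin 2) (Fin 2) ℂ ≃ₗ[ℂ] (Fin 2 → ℂ) →L[ℂ] (Fin 2 → ℂ) :=
    Matrix.toLin'.trans LinearMap.toContinuousLinearMap
  have hL : ∀ᶠ t in 𝓝 q, ContinuousAt (fun t => toCLM (systemMatrix Q z t)) t := hQ.mono
    fun t ht => (toCLM.toLinearMap.continuous_of_finiteDimensional.continuousAt).comp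
      (continuousAt_systemMatrix ht z)
  obtain ⟨Y, hYq, hY⟩ := exists_hasDerivAt_clm_apply hL ![y 0, y 1 - Q q * y 0]
  have hY' : ∀ᶠ t in 𝓝 q, HasDerivAt (fun t => Y t 0) (Q t * Y t 0 + Y t 1) t ∧
      HasDerivAt (fun t => Y t 1) ((-z - Q t ^ 2) * Y t 0 - Q t * Y t 1) t := by
    filter_upwards [hY] with t ht
    rw [hasDerivAt_pi] at ht
    refine ⟨(ht 0).congr_deriv ?_, (ht 1).congr_deriv ?_⟩ <;>
      simp [toCLM, systemMatrix, Matrix.mulVec, dotProduct, Fin.sum_univ_two, sub_eq_add_neg]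
  have hderiv : ∀ᶠ t in 𝓝 q, deriv (fun t => Y t 0) t = Q t * Y t 0 + Y t 1 :=
    hY'.mono fun t ht => ht.1.deriv
  refine ⟨fun t => Y t 0, ?_, ?_⟩
  · rw [jet, hderiv.self_of_nhds, hYq]
    ext i
    fin_cases i <;> simp
  · filter_upwards [hY', hderiv.eventually_nhds] with t ht hdt
    refine ⟨ht.1.differentiableAt, (ht.2.congr_deriv ?_).congr_of_eventuallyEq ?_⟩
    · rw [hdt.self_of_nhds]
      ring
    · filter_upwards [hdt] with r hr
      rw [hr]
      ring

theorem Regular.eventually_continuousAt (hR : Regular J Q x A) (hq : q ∈ J) :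
    ∀ᶠ t in 𝓝 q, ContinuousAt Q t :=
  (hR.isOpen.eventually_mem hq).mono fun _ => hR.continuousAt

theorem Regular.exists_solvesAt_of_notMem_range (hR : Regular J Q x A) (hq : q ∈ J \ range x)
    (z : ℂ) (y : Fin 2 → ℂ) : ∃ f, (∀ᶠ t in 𝓝 q, SolvesAt Q x A z f t) ∧ jet f q = y := by
  obtain ⟨f, hfy, hf⟩ := exists_solvesODEAt (hR.eventually_continuousAt hq.1) z y
  refine ⟨f, ?_, hfy⟩
  filter_upwards [hf, hR.isOpen_diff.mem_nhds hq] with t ht htx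
  exact ⟨fun _ => ht, fun n hn => (htx.2 ⟨n, hn⟩).elim⟩

theorem Regular.exists_solvesAt_of_mem_range (hR : Regular J Q x A) {n : ι} (hn : x n ∈ J)
    (z : ℂ) (y : Fin 2 → ℂ) :
    ∃ f, (∀ᶠ t in 𝓝 (x n), SolvesAt Q x A z f t) ∧ Tendsto (jet f) (𝓝[<] (x n)) (𝓝 y) := by
  have hQ := hR.eventually_continuousAt hn
  obtain ⟨f, hfy, hf⟩ := exists_solvesODEAt hQ z y
  obtain ⟨g, hgy, hg⟩ := exists_solvesODEAt hQ z (((A n).map Complex.ofReal).mulVec y)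
  have hf_jet := hf.self_of_nhds.continuousAt_jet hQ.self_of_nhds
  have hg_jet := hg.self_of_nhds.continuousAt_jet hQ.self_of_nhds
  obtain ⟨U, -, hU, hnU, hsolve⟩ := hR.exists_subset_of_eventually hn
    ((eventually_nhdsWithin_iff.1 (hR.discrete _ hn)).and (hf.and hg))
  have hsolvesOn : ∀ {k : ℝ → ℂ} {S : Set ℝ}, (∀ t ∈ U, SolvesODEAt Q z k t) → x n ∉ S →
      SolvesOn (U ∩ S) Q x A z k := fun hk hS t ht =>
    ⟨fun _ => hk t ht.1, fun m hm => ((hsolve t ht.1).1 (fun h => hS (h ▸ ht.2)) ⟨m, hm⟩).elim⟩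
  rw [ContinuousAt, hfy] at hf_jet
  rw [ContinuousAt, hgy] at hg_jet
  have hglue := SolvesOn.ite_lt hR.injective
    (hsolvesOn (fun t ht => (hsolve t ht).2.1) self_notMem_Iio)
    (hf_jet.mono_left nhdsWithin_le_nhds)
    (hsolvesOn (fun t ht => (hsolve t ht).2.2) self_notMem_Ioi)
    (hg_jet.mono_left nhdsWithin_le_nhds)
  have hleft : EqOn f (fun t => if t < x n then f t else g t) (Iio (x n)) :=
    fun _ ht => (if_pos ht).symm
  exact ⟨_, Filter.mem_of_superset (hU.isOpen.mem_nhds hnU) hglue,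
    (hf_jet.mono_left nhdsWithin_le_nhds).congr'
      ((eqOn_jet isOpen_Iio hleft).eventuallyEq_of_mem self_mem_nhdsWithin)⟩

theorem Regular.exists_solvesAt_tendsto_jet (hR : Regular J Q x A) (hq : q ∈ J) (z : ℂ)
    (y : Fin 2 → ℂ) :
    ∃ f, (∀ᶠ t in 𝓝 q, SolvesAt Q x A z f t) ∧ Tendsto (jet f) (𝓝[<] q) (𝓝 y) := by
  by_cases hqx : q ∈ range x
  · obtain ⟨n, rfl⟩ := hqx
    exact hR.exists_solvesAt_of_mem_range hq z y
  · obtain ⟨f, hf, hfy⟩ := hR.exists_solvesAt_of_notMem_range ⟨hq, hqx⟩ z y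
    refine ⟨f, hf, hfy ▸ ?_⟩
    exact ((hf.self_of_nhds.1 hqx).continuousAt_jet (hR.continuousAt hq)).mono_left
      nhdsWithin_le_nhds

variable [Countable ι]

theorem Regular.exists_mem_solvableOn (hR : Regular J Q x A) (hq : q ∈ J) (z : ℂ) :
    ∃ U ⊆ J, Regular U Q x A ∧ q ∈ U ∧ SolvableOn U Q x A z := by
  obtain ⟨f, hf, hfl⟩ := hR.exists_solvesAt_tendsto_jet hq z ![1, 0]
  obtain ⟨g, hg, hgl⟩ := hR.exists_solvesAt_tendsto_jet hq z ![0, 1]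
  obtain ⟨U, hUJ, hU, hqU, hsolve⟩ := hR.exists_subset_of_eventually hq (hf.and hg)
  have hW : ∀ᶠ t in 𝓝[<] q, wronskian f g t ≠ 0 :=
    (tendsto_wedge hfl hgl).eventually_ne (by simp [wedge])
  obtain ⟨s, hWs, hs⟩ :=
    (hW.and ((hU.eventually_mem_diff hqU).filter_mono (nhdsLT_le_nhdsNE q))).exists
  exact ⟨U, hUJ, hU, hqU, solvableOn_of_wronskian_ne_zero hU (fun t ht => (hsolve t ht).1)
    (fun t ht => (hsolve t ht).2) hs hWs⟩

theorem Regular.exists_mem_mem_solvableOn (hR : Regular J Q x A) (hs : s ∈ J) (ht : t ∈ J)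
    (z : ℂ) : ∃ U ⊆ J, Regular U Q x A ∧ s ∈ U ∧ t ∈ U ∧ SolvableOn U Q x A z := by
  set T := {t | ∃ U ⊆ J, Regular U Q x A ∧ s ∈ U ∧ t ∈ U ∧ SolvableOn U Q x A z}
  have hT : IsOpen T := by
    rw [isOpen_iff_mem_nhds]
    rintro t ⟨U, hUJ, hU, hsU, htU, hsolv⟩
    filter_upwards [hU.isOpen.mem_nhds htU] with r hr using ⟨U, hUJ, hU, hsU, hr, hsolv⟩
  refine hR.ordConnected.isPreconnected.subset_of_closure_inter_subset hT ⟨s, hs, ?_⟩ ?_ ht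
  · obtain ⟨U, hUJ, hU, hsU, hsolv⟩ := hR.exists_mem_solvableOn hs z
    exact ⟨U, hUJ, hU, hsU, hsU, hsolv⟩
  · rintro t ⟨htT, htJ⟩
    obtain ⟨N, hNJ, hN, htN, hsolvN⟩ := hR.exists_mem_solvableOn htJ z
    obtain ⟨r, hrN, U, hUJ, hU, hsU, hrU, hsolvU⟩ := mem_closure_iff.1 htT N hN.isOpen htN
    exact ⟨U ∪ N, union_subset hUJ hNJ, hU.union hN ⟨r, hrU, hrN⟩, .inl hsU, .inr htN,
      hsolvU.union hU hN ⟨r, hrU, hrN⟩ hsolvN⟩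

theorem Regular.solvableOn (hR : Regular J Q x A) (z : ℂ) : SolvableOn J Q x A z := by
  intro s hs y
  choose U hUJ hU hsU htU hsolv using
    fun t : J => hR.exists_mem_mem_solvableOn hs.1 t.2 z
  choose F hF hFs using fun t : J => hsolv t s ⟨hsU t, hs.2⟩ y
  have hcover : ⋃ t, U t = J :=
    (iUnion_subset hUJ).antisymm fun t ht => mem_iUnion.2 ⟨⟨t, ht⟩, htU ⟨t, ht⟩⟩
  obtain ⟨f, hf, hfF⟩ := exists_solvesOn_iUnion hU hF fun i j =>
    ((hsolv i).mono inter_subset_left).eqOn ((hU i).inter (hU j)) ((hF i).mono inter_subset_left)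
      ((hF j).mono inter_subset_right) ⟨⟨hsU i, hsU j⟩, hs.2⟩ ((hFs i).trans (hFs j).symm)
  refine ⟨f, hcover ▸ hf, ?_⟩
  let i : J := ⟨s, hs.1⟩
  exact (eqOn_jet (hU i).isOpen_diff (hfF i) ⟨hsU i, hs.2⟩).trans (hFs i)

theorem SolvesOn.exists_extension (hR : Regular J Q x A) (hU : Regular U Q x A) (hUJ : U ⊆ J)
    (hne : U.Nonempty) (hf : SolvesOn U Q x A z f) :
    ∃ g, SolvesOn J Q x A z g ∧ EqOn g f (U \ range x) := by
  obtain ⟨g, hg, hgf⟩ := (hR.solvableOn z).exists_extension hU hR (by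
    rwa [inter_eq_self_of_subset_left hUJ]) hf
  exact ⟨g, union_eq_self_of_subset_left hUJ ▸ hg, hgf⟩

end Solutions

/-! ### Absolute continuity and the quasi-derivative -/

section QuasiDerivative

variable {I : Set ℤ} {J : Set ℝ} {Q V : ℝ → ℝ} {x : I → ℝ} {κ : Couplings I} {a b a' b' : EReal}
  {z : ℂ} {f F G : ℝ → ℂ} {c d q s t : ℝ}

theorem absolutelyContinuousOnInterval_of_hasDerivAt (hcd : c ≤ d)
    (hF : ∀ t ∈ Icc c d, HasDerivAt F (G t) t) (hG : ContinuousOn G (Icc c d)) :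
    AbsolutelyContinuousOnInterval F c d := by
  obtain ⟨C, hC⟩ := isCompact_Icc.exists_bound_of_continuousOn hG
  have hlip : LipschitzOnWith C.toNNReal F (uIcc c d) := by
    rw [uIcc_of_le hcd]
    refine (convex_Icc c d).lipschitzOnWith_of_nnnorm_hasDerivWithin_le
      (fun t ht => (hF t ht).hasDerivWithinAt) fun t ht => ?_
    rw [← NNReal.coe_le_coe]
    exact (hC t ht).trans (Real.le_coe_toNNReal C)
  exact hlip.absolutelyContinuousOnInterval

theorem hasDerivAt_of_ae_hasDerivAt (hF : AbsolutelyContinuousOnInterval F c d)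
    (hG : ContinuousOn G (Icc c d)) (hFG : ∀ᵐ t, t ∈ Icc c d → HasDerivAt F (G t) t)
    (ht : t ∈ Ioo c d) : HasDerivAt F (G t) t := by
  have hcd : c ≤ d := (ht.1.trans ht.2).le
  let G' : ℝ → ℂ := IccExtend hcd ((Icc c d).domRestrict G)
  have hG' : Continuous G' := (continuousOn_iff_continuous_domRestrict.1 hG).Icc_extend'
  have hGG' : ∀ t ∈ Icc c d, G' t = G t := fun t ht => IccExtend_of_mem hcd _ ht
  let P : ℝ → ℂ := fun t => ∫ r in c..t, G' r
  have hP : ∀ t, HasDerivAt P (G' t) t := fun t => (hG'.integral_hasStrictDerivAt c t).hasDerivAt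
  have hPac : AbsolutelyContinuousOnInterval P c d :=
    absolutelyContinuousOnInterval_of_hasDerivAt hcd (fun t _ => hP t) hG'.continuousOn
  have hderiv : ∀ᵐ t, t ∈ uIcc c d → HasDerivAt (F - P) 0 t := by
    rw [uIcc_of_le hcd]
    filter_upwards [hFG] with t h ht
    rw [← sub_self (G t)]
    exact (h ht).sub (hGG' t ht ▸ hP t)
  obtain ⟨C, hC⟩ := (hF.sub hPac).const_of_ae_hasDerivAt_zero hderiv
  rw [uIcc_of_le hcd] at hC
  rw [← hGG' t (Ioo_subset_Icc_self ht)]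
  refine ((hP t).const_add C).congr_of_eventuallyEq ?_
  filter_upwards [Icc_mem_nhds ht.1 ht.2] with r hr
  rw [← hC r hr, Pi.sub_apply, sub_add_cancel]

theorem ae_hasDerivAt_deriv (hcd : c ≤ d) (hF : AbsolutelyContinuousOnInterval F c d) :
    ∀ᵐ t, t ∈ Icc c d → HasDerivAt F (deriv F t) t := by
  have h := hF.boundedVariationOn.ae_differentiableAt_of_mem_uIcc
  rw [uIcc_of_le hcd] at h
  filter_upwards [h] with t ht htI using (ht htI).hasDerivAt

theorem solvesODEAt_of_absolutelyContinuous (hQ : AbsolutelyContinuousOnInterval Q c d)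
    (hf : AbsolutelyContinuousOnInterval f c d) (hf' : AbsolutelyContinuousOnInterval (deriv f) c d)
    (hQV : ∀ᵐ t, t ∈ Icc c d → HasDerivAt Q (V t) t)
    (hτ : ∀ᵐ t, t ∈ Icc c d → tau V f t - z * f t = 0) (hq : q ∈ Ioo c d) :
    SolvesODEAt Q z f q := by
  have hcd : c ≤ d := (hq.1.trans hq.2).le
  have hcont := hf.continuousOn
  have hcont' := hf'.continuousOn
  have hcontQ := Complex.continuous_ofReal.comp_continuousOn hQ.continuousOn
  rw [uIcc_of_le hcd] at hcont hcont' hcontQ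
  have hquasi : AbsolutelyContinuousOnInterval (fun t => deriv f t - Q t * f t) c d := by
    simpa only [Pi.sub_def, Pi.smul_apply', Complex.real_smul] using hf'.sub (hQ.smul hf)
  refine ⟨(hasDerivAt_of_ae_hasDerivAt hf hcont' (ae_hasDerivAt_deriv hcd hf) hq).differentiableAt,
    hasDerivAt_of_ae_hasDerivAt (G := fun t => -z * f t - Q t * deriv f t) hquasi
      ((continuousOn_const.mul hcont).sub (hcontQ.mul hcont')) ?_ hq⟩
  filter_upwards [hτ, hQV, ae_hasDerivAt_deriv hcd hf, ae_hasDerivAt_deriv hcd hf']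
    with t hτt hQt hft hft' ht
  refine ((hft' ht).sub ((hQt ht).ofReal_comp.mul (hft ht))).congr_deriv ?_
  have hode := hτt ht
  simp only [tau] at hode
  linear_combination -hode

/-! ### Primitives of the potential -/

/-- The primitive of the potential `V` that vanishes at `c`. -/
def primitive (V : ℝ → ℝ) (c t : ℝ) : ℝ := ∫ r in c..t, V r

theorem intervalIntegrable_min_max (hJ : J.OrdConnected) (hV : LocallyIntegrableOn V J)
    (hc : c ∈ J) (hs : s ∈ J) (ht : t ∈ J) :
    IntervalIntegrable V volume (min c s) (max c t) :=
  (hV.integrableOn_compact_subset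
    (hJ.uIcc_subset (min_rec' (· ∈ J) hc hs) (max_rec' (· ∈ J) hc ht))
    isCompact_uIcc).intervalIntegrable

theorem uIcc_min_max (c s t : ℝ) : uIcc (min c s) (max c t) = Icc (min c s) (max c t) :=
  uIcc_of_le ((min_le_left _ _).trans (le_max_left _ _))

theorem mem_uIcc_min_max (c s t : ℝ) : c ∈ uIcc (min c s) (max c t) :=
  uIcc_min_max c s t ▸ ⟨min_le_left _ _, le_max_left _ _⟩

theorem Icc_subset_uIcc_min_max (c s t : ℝ) : Icc s t ⊆ uIcc (min c s) (max c t) :=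
  uIcc_min_max c s t ▸ Icc_subset_Icc (min_le_right _ _) (le_max_right _ _)

theorem absolutelyContinuousOnInterval_primitive (hJ : J.OrdConnected)
    (hV : LocallyIntegrableOn V J) (hc : c ∈ J) (hst : s ≤ t) (hsub : Icc s t ⊆ J) :
    AbsolutelyContinuousOnInterval (primitive V c) s t := by
  have hInt := intervalIntegrable_min_max hJ hV hc (hsub (left_mem_Icc.2 hst))
    (hsub (right_mem_Icc.2 hst))
  refine (hInt.absolutelyContinuousOnInterval_intervalIntegral (mem_uIcc_min_max c s t)).mono ?_
  rw [uIcc_of_le hst]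
  exact Icc_subset_uIcc_min_max c s t

theorem exists_Icc_mem_nhds_subset (hJ : IsOpen J) (hq : q ∈ J) :
    ∃ s t, q ∈ Ioo s t ∧ Icc s t ⊆ J := by
  obtain ⟨δ, hδ, hsub⟩ := Metric.nhds_basis_closedBall.mem_iff.1 (hJ.mem_nhds hq)
  exact ⟨q - δ, q + δ, ⟨by linarith, by linarith⟩, Real.closedBall_eq_Icc ▸ hsub⟩

theorem ae_hasDerivAt_primitive (hJo : IsOpen J) (hJ : J.OrdConnected)
    (hV : LocallyIntegrableOn V J) (hc : c ∈ J) :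
    ∀ᵐ t, t ∈ J → HasDerivAt (primitive V c) (V t) t := by
  rw [ae_iff]
  refine measure_null_of_locally_null _ fun q hq => ?_
  obtain ⟨s, t, hqst, hsub⟩ := exists_Icc_mem_nhds_subset hJo (Classical.not_imp.1 hq).1
  have hst := (hqst.1.trans hqst.2).le
  have hInt := intervalIntegrable_min_max hJ hV hc (hsub (left_mem_Icc.2 hst))
    (hsub (right_mem_Icc.2 hst))
  have hae : ∀ᵐ r, r ∈ Icc s t → HasDerivAt (primitive V c) (V r) r :=
    hInt.ae_hasDerivAt_integral.mono fun r hr hrst =>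
      hr (Icc_subset_uIcc_min_max c s t hrst) c (mem_uIcc_min_max c s t)
  refine ⟨_, inter_mem (nhdsWithin_le_nhds (Icc_mem_nhds hqst.1 hqst.2)) self_mem_nhdsWithin,
    measure_mono_null ?_ (ae_iff.1 hae)⟩
  exact fun r hr hrst => hr.2 fun _ => hrst hr.1

theorem continuousOn_primitive (hJo : IsOpen J) (hJ : J.OrdConnected)
    (hV : LocallyIntegrableOn V J) (hc : c ∈ J) : ContinuousOn (primitive V c) J := by
  intro q hq
  obtain ⟨s, t, hqst, hsub⟩ := exists_Icc_mem_nhds_subset hJo hq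
  have hst := (hqst.1.trans hqst.2).le
  have hcont := (absolutelyContinuousOnInterval_primitive hJ hV hc hst hsub).continuousOn
  rw [uIcc_of_le hst] at hcont
  exact (hcont.continuousAt (Icc_mem_nhds hqst.1 hqst.2)).continuousWithinAt

/-! ### The operator's solutions as solutions of the quasi-differential equation -/

theorem isOpen_interval (a b : EReal) : IsOpen (interval a b) :=
  (isOpen_Ioo (a := a) (b := b)).preimage continuous_coe_real_ereal

theorem ordConnected_interval (a b : EReal) : (interval a b).OrdConnected :=
  ⟨fun _ hs _ ht _ hr => ⟨hs.1.trans_le (EReal.coe_le_coe_iff.2 hr.1),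
    (EReal.coe_le_coe_iff.2 hr.2).trans_lt ht.2⟩⟩

theorem interval_subset_interval (ha : a ≤ a') (hb : b' ≤ b) : interval a' b' ⊆ interval a b :=
  fun _ ht => ⟨ha.trans_lt ht.1, ht.2.trans_le hb⟩

theorem det_interactionMatrix {α r θ : ℝ} (hr : r ≠ 0) : (interactionMatrix α r θ).det = 1 := by
  rw [interactionMatrix, Matrix.det_mul, Matrix.det_mul, parabolic, hyperbolic, elliptic,
    Matrix.det_fin_two_of, Matrix.det_fin_two_of, Matrix.det_fin_two_of]
  field_simp
  linear_combination Real.sin_sq_add_cos_sq θ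

theorem regular_interval (hV : LocallyIntegrableOn V (interval a b))
    (hx_inj : Function.Injective x) (hx_acc : ∀ p ∈ interval a b, ¬ AccPt p (𝓟 (range x)))
    (hr : ∀ n, 0 < κ.r n) (hc : c ∈ interval a b) :
    Regular (interval a b) (primitive V c) x κ.matrix where
  isOpen := isOpen_interval a b
  ordConnected := ordConnected_interval a b
  discrete q hq := by simpa only [accPt_iff_frequently_nhdsNE, not_frequently] using hx_acc q hq
  continuousOn := continuousOn_primitive (isOpen_interval a b) (ordConnected_interval a b) hV hc
  det n := det_interactionMatrix (hr n).ne'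
  injective := hx_inj

theorem IsSolution.solvesOn (hV : LocallyIntegrableOn V (interval a b)) (hc : c ∈ interval a b)
    (hsub : interval a' b' ⊆ interval a b)
    (hR : Regular (interval a' b') (primitive V c) x κ.matrix) (hf : IsSolution a' b' V x κ z f) :
    SolvesOn (interval a' b') (primitive V c) x κ.matrix z f := by
  intro q hq
  refine ⟨fun hqx => ?_, fun n hn => hn ▸ hf.1.2.2 n (hn ▸ hq)⟩
  obtain ⟨s, t, hqst, hst⟩ := exists_Icc_mem_nhds_subset hR.isOpen_diff ⟨hq, hqx⟩
  have hle : s ≤ t := (hqst.1.trans hqst.2).le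
  have hst' : Icc s t ⊆ interval a b := fun r hr => hsub (hst hr).1
  refine solvesODEAt_of_absolutelyContinuous (V := V)
    (absolutelyContinuousOnInterval_primitive (ordConnected_interval a b) hV hc hle hst')
    (hf.1.1 s t hle hst) (hf.1.2.1 s t hle hst) ?_ ?_ hqst
  · exact (ae_hasDerivAt_primitive (isOpen_interval a b) (ordConnected_interval a b) hV hc).mono
      fun r hr hrst => hr (hst' hrst)
  · exact ((ae_restrict_iff' (isOpen_interval a' b').measurableSet).1 hf.2).mono
      fun r hr hrst => hr (hst hrst).1

theorem SolvesOn.absolutelyContinuousOnInterval_deriv (hR : Regular J Q x κ.matrix)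
    (hf : SolvesOn J Q x κ.matrix z f) (hst : s ≤ t) (hsub : Icc s t ⊆ J \ range x)
    (hQ : AbsolutelyContinuousOnInterval Q s t) (hfac : AbsolutelyContinuousOnInterval f s t) :
    AbsolutelyContinuousOnInterval (deriv f) s t := by
  have hcontQ : ContinuousOn (fun r => (Q r : ℂ)) (Icc s t) :=
    Complex.continuous_ofReal.comp_continuousOn (hR.continuousOn.mono fun r hr => (hsub hr).1)
  have hquasi : AbsolutelyContinuousOnInterval (fun r => deriv f r - Q r * f r) s t :=
    absolutelyContinuousOnInterval_of_hasDerivAt hst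
      (fun r hr => hf.hasDerivAt_quasiDeriv (hsub hr))
      ((continuousOn_const.mul (hf.continuousOn.mono hsub)).sub
        (hcontQ.mul ((hf.continuousOn_deriv hR).mono hsub)))
  simpa only [Pi.add_def, Pi.smul_apply', Complex.real_smul, sub_add_cancel]
    using hquasi.add (hQ.smul hfac)

theorem SolvesODEAt.tau_sub_eq_zero (hf : SolvesODEAt Q z f t) (hQ : HasDerivAt Q (V t) t) :
    tau V f t - z * f t = 0 := by
  have hderiv : HasDerivAt (deriv f) _ t :=
    (hf.2.add (hQ.ofReal_comp.mul hf.1.hasDerivAt)).congr_of_eventuallyEq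
      (Eventually.of_forall fun r => by simp)
  rw [tau, hderiv.deriv]
  ring

theorem SolvesOn.isSolution (hV : LocallyIntegrableOn V (interval a b)) (hc : c ∈ interval a b)
    (hsub : interval a' b' ⊆ interval a b)
    (hR : Regular (interval a' b') (primitive V c) x κ.matrix)
    (hf : SolvesOn (interval a' b') (primitive V c) x κ.matrix z f) :
    IsSolution a' b' V x κ z f := by
  have hac : LocallyAC f (interval a' b' \ range x) := fun s t hst hI =>
    absolutelyContinuousOnInterval_of_hasDerivAt hst (fun r hr => hf.hasDerivAt (hI hr))
      ((hf.continuousOn_deriv hR).mono hI)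
  refine ⟨⟨hac, fun s t hst hI => ?_, fun n hn => (hf _ hn).2 n rfl⟩, ?_⟩
  · exact hf.absolutelyContinuousOnInterval_deriv hR hst hI
      (absolutelyContinuousOnInterval_primitive (ordConnected_interval a b) hV hc hst
        fun r hr => hsub (hI hr).1) (hac s t hst hI)
  · rw [ae_restrict_iff' (isOpen_interval a' b').measurableSet]
    filter_upwards [ae_notMem_range x Measure.AbsolutelyContinuous.rfl,
      ae_hasDerivAt_primitive (isOpen_interval a b) (ordConnected_interval a b) hV hc]
      with t htx hQt ht
    exact ((hf t ht).1 htx).tau_sub_eq_zero (hQt (hsub ht))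

theorem isSolution_iff_solvesOn (hV : LocallyIntegrableOn V (interval a b))
    (hc : c ∈ interval a b) (hsub : interval a' b' ⊆ interval a b)
    (hR : Regular (interval a' b') (primitive V c) x κ.matrix) :
    IsSolution a' b' V x κ z f ↔ SolvesOn (interval a' b') (primitive V c) x κ.matrix z f :=
  ⟨fun hf => hf.solvesOn hV hc hsub hR, fun hf => hf.isSolution hV hc hsub hR⟩

end QuasiDerivative

/-! ### End points -/

section EndPoints

variable {ι : Type*} {J J' N : Set ℝ} {Q : ℝ → ℝ} {x : ι → ℝ} {A : ι → Matrix (Fin 2) (Fin 2) ℝ}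
  {f g : ℝ → ℂ} {l : Filter ℝ} {a b : EReal}

/-- `l` is the filter of neighbourhoods of an end point of an interval. This treats both end points,
finite or infinite, alike. -/
structure IsEnd (l : Filter ℝ) : Prop where
  neBot : l.NeBot
  isCountablyGenerated : l.IsCountablyGenerated
  hasBasis : l.HasBasis (fun N => N ∈ l ∧ IsOpen N ∧ N.OrdConnected) id
  compl_singleton_mem : ∀ t, {t}ᶜ ∈ l

namespace IsEnd

theorem neBot_inf_compl (hl : IsEnd l) {S : Set ℝ} (hS : S.Countable) : (l ⊓ 𝓟 Sᶜ).NeBot := by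
  rw [hl.hasBasis.inf_principal_neBot_iff]
  rintro N ⟨hN, hopen, -⟩
  exact (hS.dense_compl ℝ).inter_open_nonempty N hopen (hl.neBot.nonempty_of_mem hN)

theorem exists_setIntegral_le (hl : IsEnd l) (hN : N ∈ l) {k : ℝ → ℝ} (hk : IntegrableOn k N)
    {ε : ℝ} (hε : 0 < ε) :
    ∃ N' ∈ l, N' ⊆ N ∧ IsOpen N' ∧ N'.OrdConnected ∧ ∫ t in N', k t ≤ ε := by
  have := hl.isCountablyGenerated
  obtain ⟨N₀, ⟨hN₀l, hN₀, -⟩, hN₀N⟩ := hl.hasBasis.mem_iff.1 hN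
  obtain ⟨B, hB, hBl⟩ := hl.hasBasis.exists_antitone_subbasis
  simp only [id] at hBl
  have hempty : ⋂ i, N₀ ∩ B i = ∅ := by
    refine eq_empty_of_forall_notMem fun t ht => ?_
    obtain ⟨i, hi⟩ := hBl.mem_iff.1 (hl.compl_singleton_mem t)
    exact hi (mem_iInter.1 ht i).2 rfl
  have hlim := tendsto_setIntegral_of_antitone (μ := volume) (f := k) (s := fun i => N₀ ∩ B i)
    (fun i => (hN₀.inter (hB i).2.1).measurableSet)
    (fun i j hij => inter_subset_inter_right _ (hBl.antitone hij))
    ⟨0, hk.mono_set (inter_subset_left.trans hN₀N)⟩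
  rw [hempty, setIntegral_empty] at hlim
  obtain ⟨i, hi, hiN₀⟩ := ((hlim.eventually_le_const hε).and (hBl.eventually_subset hN₀l)).exists
  rw [inter_eq_right.2 hiN₀] at hi
  exact ⟨B i, (hB i).1, hiN₀.trans hN₀N, (hB i).2.1, (hB i).2.2, hi⟩

end IsEnd

/-- The filter of right neighbourhoods of `a` in the reals. -/
def leftEnd (a : EReal) : Filter ℝ := comap (fun t : ℝ => (t : EReal)) (𝓝[>] a)

/-- The filter of left neighbourhoods of `b` in the reals. -/
def rightEnd (b : EReal) : Filter ℝ := comap (fun t : ℝ => (t : EReal)) (𝓝[<] b)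

theorem nonempty_interval (hab : a < b) : (interval a b).Nonempty :=
  EReal.lt_iff_exists_real_btwn.1 hab

theorem hasBasis_leftEnd (hab : a < b) :
    (leftEnd a).HasBasis (fun c : ℝ => c ∈ interval a b) fun c => interval a c := by
  refine ((nhdsGT_basis_of_exists_gt ⟨b, hab⟩).comap _).to_hasBasis (fun u hu => ?_)
    fun c hc => ⟨c, hc.1, Subset.rfl⟩
  obtain ⟨c, hac, hc⟩ := nonempty_interval (lt_min hu hab)
  exact ⟨c, ⟨hac, hc.trans_le (min_le_right _ _)⟩,
    fun t ht => ⟨ht.1, (ht.2.trans hc).trans_le (min_le_left _ _)⟩⟩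

theorem hasBasis_rightEnd (hab : a < b) :
    (rightEnd b).HasBasis (fun c : ℝ => c ∈ interval a b) fun c => interval c b := by
  refine ((nhdsLT_basis_of_exists_lt ⟨a, hab⟩).comap _).to_hasBasis (fun u hu => ?_)
    fun c hc => ⟨c, hc.2, Subset.rfl⟩
  obtain ⟨c, hc, hcb⟩ := nonempty_interval (max_lt hu hab)
  exact ⟨c, ⟨(le_max_right _ _).trans_lt hc, hcb⟩,
    fun t ht => ⟨((le_max_left _ _).trans_lt hc).trans ht.1, ht.2⟩⟩

theorem interval_mem_leftEnd (hab : a < b) : interval a b ∈ leftEnd a := by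
  obtain ⟨c, hc⟩ := nonempty_interval hab
  exact mem_of_superset ((hasBasis_leftEnd hab).mem_of_mem hc)
    (interval_subset_interval le_rfl hc.2.le)

theorem interval_mem_rightEnd (hab : a < b) : interval a b ∈ rightEnd b := by
  obtain ⟨c, hc⟩ := nonempty_interval hab
  exact mem_of_superset ((hasBasis_rightEnd hab).mem_of_mem hc)
    (interval_subset_interval hc.1.le le_rfl)

theorem compl_singleton_mem_comap (S : Set EReal) {c : EReal} (hc : c ∉ S) (t : ℝ) :
    {t}ᶜ ∈ comap (fun t : ℝ => (t : EReal)) (𝓝[S] c) := by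
  refine ⟨{(t : EReal)}ᶜ, ?_, fun r hr hrt => hr (congrArg _ hrt)⟩
  rcases eq_or_ne c t with rfl | hct
  · exact mem_of_superset self_mem_nhdsWithin fun r hr hrt => hc (mem_singleton_iff.1 hrt ▸ hr)
  · exact nhdsWithin_le_nhds (isOpen_compl_singleton.mem_nhds hct)

theorem isEnd_leftEnd (hab : a < b) : IsEnd (leftEnd a) where
  neBot := (hasBasis_leftEnd hab).neBot_iff.2 fun hc => nonempty_interval hc.1
  isCountablyGenerated := by unfold leftEnd; infer_instance
  hasBasis := (hasBasis_leftEnd hab).to_hasBasis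
    (fun c hc => ⟨_, ⟨interval_mem_leftEnd hc.1, isOpen_interval a c,
      ordConnected_interval a c⟩, Subset.rfl⟩)
    fun _ hN => (hasBasis_leftEnd hab).mem_iff.1 hN.1
  compl_singleton_mem := compl_singleton_mem_comap (Ioi a) (lt_irrefl a)

theorem isEnd_rightEnd (hab : a < b) : IsEnd (rightEnd b) where
  neBot := (hasBasis_rightEnd hab).neBot_iff.2 fun hc => nonempty_interval hc.2
  isCountablyGenerated := by unfold rightEnd; infer_instance
  hasBasis := (hasBasis_rightEnd hab).to_hasBasis
    (fun c hc => ⟨_, ⟨interval_mem_rightEnd hc.2, isOpen_interval c b,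
      ordConnected_interval c b⟩, Subset.rfl⟩)
    fun _ hN => (hasBasis_rightEnd hab).mem_iff.1 hN.1
  compl_singleton_mem := compl_singleton_mem_comap (Iio b) (lt_irrefl b)

/-- `f` is square integrable near the end `l`. -/
def LiesAt (l : Filter ℝ) (f : ℝ → ℂ) : Prop := ∃ N ∈ l, MemLp f 2 (volume.restrict N)

theorem liesAt_iff_of_hasBasis {σ : Type*} {p : σ → Prop} {B : σ → Set ℝ} (hl : l.HasBasis p B) :
    LiesAt l f ↔ ∃ i, p i ∧ MemLp f 2 (volume.restrict (B i)) :=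
  hl.exists_iff fun _ _ hsub hf => hf.mono_measure (Measure.restrict_mono_set _ hsub)

theorem liesLeft_iff (hab : a < b) : LiesLeft a b f ↔ LiesAt (leftEnd a) f :=
  (liesAt_iff_of_hasBasis (hasBasis_leftEnd hab)).symm

theorem liesRight_iff (hab : a < b) : LiesRight a b f ↔ LiesAt (rightEnd b) f :=
  (liesAt_iff_of_hasBasis (hasBasis_rightEnd hab)).symm

theorem LiesAt.congr [Countable ι] (hJ : MeasurableSet J) (hJl : J ∈ l) (hf : LiesAt l f)
    (hfg : EqOn f g (J \ range x)) : LiesAt l g := by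
  obtain ⟨N, hN, hfN⟩ := hf
  refine ⟨J ∩ N, inter_mem hJl hN,
    (hfN.mono_measure (Measure.restrict_mono_set _ inter_subset_right)).ae_eq ?_⟩
  filter_upwards [ae_mono (Measure.restrict_mono_set _ inter_subset_left) (ae_restrict_mem hJ),
    ae_notMem_range x Measure.restrict_le_self.absolutelyContinuous] with t ht htx
    using hfg ⟨ht, htx⟩

/-- The limit circle case at the end `l` of `J`: all solutions on `J` are square integrable
near `l`. -/
def LimitCircleAt (l : Filter ℝ) (J : Set ℝ) (Q : ℝ → ℝ) (x : ι → ℝ)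
    (A : ι → Matrix (Fin 2) (Fin 2) ℝ) : Prop :=
  ∀ z f, SolvesOn J Q x A z f → LiesAt l f

theorem limitCircleAt_iff_of_subset [Countable ι] (hR' : Regular J' Q x A) (hR : Regular J Q x A)
    (hl : IsEnd l) (hJ : J ∈ l) (hsub : J ⊆ J') :
    LimitCircleAt l J' Q x A ↔ LimitCircleAt l J Q x A := by
  refine ⟨fun h z f hf => ?_, fun h z f hf => h z f (hf.mono hsub)⟩
  obtain ⟨g, hg, hgf⟩ := hf.exists_extension hR' hR hsub (hl.neBot.nonempty_of_mem hJ)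
  exact (h z g hg).congr hR.isOpen.measurableSet hJ hgf

theorem limitCircleAt_congr_matrix {A' : ι → Matrix (Fin 2) (Fin 2) ℝ}
    (hA : ∀ n, x n ∈ J → A n = A' n) : LimitCircleAt l J Q x A ↔ LimitCircleAt l J Q x A' :=
  forall₂_congr fun _ _ => imp_congr_left
    ⟨fun hf => hf.congr_matrix hA, fun hf => hf.congr_matrix fun n hn => (hA n hn).symm⟩

end EndPoints

/-! ### Weyl's alternative -/

section WeylAlternative

variable {ι : Type*} {J N : Set ℝ} {Q : ℝ → ℝ} {x : ι → ℝ} {A : ι → Matrix (Fin 2) (Fin 2) ℝ}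
  {e z : ℂ} {f g u₁ u₂ : ℝ → ℂ} {l : Filter ℝ} {r s t : ℝ}

/-- A fundamental system of square integrable solutions for the spectral parameter `e`, normalised
to have Wronskian `1`. -/
structure IsL2Pair (J : Set ℝ) (Q : ℝ → ℝ) (x : ι → ℝ) (A : ι → Matrix (Fin 2) (Fin 2) ℝ) (e : ℂ)
    (u₁ u₂ : ℝ → ℂ) : Prop where
  fst : SolvesOn J Q x A e u₁
  snd : SolvesOn J Q x A e u₂
  wronskian_eq : ∀ t ∈ J \ range x, wronskian u₁ u₂ t = 1
  memLp_fst : MemLp u₁ 2 (volume.restrict J)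
  memLp_snd : MemLp u₂ 2 (volume.restrict J)

/-- The size of the coefficients of `g` in its expansion with respect to a fundamental system
`u₁`, `u₂`. -/
def coeffNorm (u₁ u₂ g : ℝ → ℂ) (t : ℝ) : ℝ := ‖wronskian g u₁ t‖ + ‖wronskian g u₂ t‖

theorem coeffNorm_nonneg (u₁ u₂ g : ℝ → ℂ) (t : ℝ) : 0 ≤ coeffNorm u₁ u₂ g t :=
  add_nonneg (norm_nonneg _) (norm_nonneg _)

theorem le_two_mul_of_forall_le_add_half {σ : Type*} {S : Set σ} {φ : σ → ℝ} {C : ℝ}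
    (hφ : BddAbove (φ '' S)) (himp : ∀ m, (∀ i ∈ S, φ i ≤ m) → ∀ i ∈ S, φ i ≤ C + m / 2) {i : σ}
    (hi : i ∈ S) : φ i ≤ 2 * C := by
  have hle : ∀ j ∈ S, φ j ≤ sSup (φ '' S) := fun j hj => le_csSup hφ (mem_image_of_mem φ hj)
  have hsup : sSup (φ '' S) ≤ C + sSup (φ '' S) / 2 :=
    csSup_le ⟨φ i, mem_image_of_mem φ hi⟩ (forall_mem_image.2 (himp _ hle))
  linarith [hle i hi]

theorem SolvesOn.norm_wronskian_le [Countable ι] (hR : Regular J Q x A)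
    (hg : SolvesOn J Q x A z g) (hf : SolvesOn J Q x A e f) (hr : r ∈ J \ range x)
    (ht : t ∈ J \ range x) :
    ‖wronskian g f r‖ ≤ ‖wronskian g f t‖ + ‖z - e‖ * ∫ y in uIoc t r, ‖g y * f y‖ := by
  have hgreen := hg.wronskian_sub hR hf ht hr
  calc ‖wronskian g f r‖
      ≤ ‖wronskian g f t‖ + ‖wronskian g f r - wronskian g f t‖ := norm_le_norm_add_norm_sub' _ _
    _ ≤ _ := by
      rw [hgreen, norm_mul]
      gcongr
      exact intervalIntegral.norm_integral_le_integral_norm_uIoc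

namespace IsL2Pair

theorem mono (hu : IsL2Pair J Q x A e u₁ u₂) (hN : N ⊆ J) : IsL2Pair N Q x A e u₁ u₂ where
  fst := hu.fst.mono hN
  snd := hu.snd.mono hN
  wronskian_eq t ht := hu.wronskian_eq t ⟨hN ht.1, ht.2⟩
  memLp_fst := hu.memLp_fst.mono_measure (Measure.restrict_mono_set _ hN)
  memLp_snd := hu.memLp_snd.mono_measure (Measure.restrict_mono_set _ hN)

theorem integrableOn_sq (hu : IsL2Pair J Q x A e u₁ u₂) :
    IntegrableOn (fun t => (‖u₁ t‖ + ‖u₂ t‖) ^ 2) J :=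
  (hu.memLp_fst.norm.add hu.memLp_snd.norm).integrable_sq

theorem jet_eq (hu : IsL2Pair J Q x A e u₁ u₂) (g : ℝ → ℂ) (ht : t ∈ J \ range x) :
    jet g t = wronskian g u₂ t • jet u₁ t - wronskian g u₁ t • jet u₂ t := by
  have h := wedge_smul_eq_sub (jet u₁ t) (jet u₂ t) (jet g t)
  rwa [← wronskian, hu.wronskian_eq t ht, one_smul] at h

theorem norm_le (hu : IsL2Pair J Q x A e u₁ u₂) (g : ℝ → ℂ) (ht : t ∈ J \ range x) :
    ‖g t‖ ≤ coeffNorm u₁ u₂ g t * (‖u₁ t‖ + ‖u₂ t‖) := by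
  have hexp : g t = wronskian g u₂ t * u₁ t - wronskian g u₁ t * u₂ t :=
    congrFun (hu.jet_eq g ht) 0
  calc ‖g t‖ ≤ ‖wronskian g u₂ t‖ * ‖u₁ t‖ + ‖wronskian g u₁ t‖ * ‖u₂ t‖ := by
        rw [hexp, ← norm_mul, ← norm_mul]
        exact norm_sub_le _ _
    _ ≤ coeffNorm u₁ u₂ g t * ‖u₁ t‖ + coeffNorm u₁ u₂ g t * ‖u₂ t‖ := by
        gcongr
        exacts [le_add_of_nonneg_left (norm_nonneg _), le_add_of_nonneg_right (norm_nonneg _)]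
    _ = coeffNorm u₁ u₂ g t * (‖u₁ t‖ + ‖u₂ t‖) := (mul_add _ _ _).symm

theorem jet_eq_zero (hu : IsL2Pair J Q x A e u₁ u₂) (ht : t ∈ J \ range x)
    (hg : coeffNorm u₁ u₂ g t = 0) : jet g t = 0 := by
  obtain ⟨h₁, h₂⟩ := (add_eq_zero_iff_of_nonneg (norm_nonneg _) (norm_nonneg _)).1 hg
  rw [hu.jet_eq g ht, norm_eq_zero.1 h₁, norm_eq_zero.1 h₂, zero_smul, zero_smul, sub_zero]

theorem exists_small (hl : IsEnd l) (hR : Regular J Q x A) (hJ : J ∈ l)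
    (hu : IsL2Pair J Q x A e u₁ u₂) (z : ℂ) : ∃ N ∈ l, N ⊆ J ∧ Regular N Q x A ∧
      ‖z - e‖ * ∫ t in N, (‖u₁ t‖ + ‖u₂ t‖) ^ 2 ≤ 1 / 2 := by
  obtain ⟨N, hN, hNJ, hopen, hord, hle⟩ := hl.exists_setIntegral_le hJ hu.integrableOn_sq
    (ε := 1 / (2 * (‖z - e‖ + 1))) (by positivity)
  refine ⟨N, hN, hNJ, hR.mono hopen hord hNJ, ?_⟩
  calc ‖z - e‖ * ∫ t in N, (‖u₁ t‖ + ‖u₂ t‖) ^ 2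
      ≤ (‖z - e‖ + 1) * (1 / (2 * (‖z - e‖ + 1))) := by
        gcongr
        exact le_add_of_nonneg_right zero_le_one
    _ = 1 / 2 := by field_simp

section Countable

variable [Countable ι]

theorem integrableOn_mul (hR : Regular J Q x A) (hu : IsL2Pair J Q x A e u₁ u₂)
    (hg : SolvesOn J Q x A z g) (hs : s ∈ J) (ht : t ∈ J) :
    IntegrableOn (fun y => ‖g y‖ * (‖u₁ y‖ + ‖u₂ y‖)) (uIoc t s) := by
  have h₁ := (intervalIntegrable_iff.1 (hg.intervalIntegrable_mul hR hu.fst ht hs)).norm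
  have h₂ := (intervalIntegrable_iff.1 (hg.intervalIntegrable_mul hR hu.snd ht hs)).norm
  have hsum := h₁.add h₂
  simp only [Pi.add_def, norm_mul, ← mul_add] at hsum
  exact hsum

theorem coeffNorm_le_add (hR : Regular J Q x A) (hu : IsL2Pair J Q x A e u₁ u₂)
    (hg : SolvesOn J Q x A z g) (hs : s ∈ J \ range x) (ht : t ∈ J \ range x) :
    coeffNorm u₁ u₂ g s ≤
      coeffNorm u₁ u₂ g t + ‖z - e‖ * ∫ y in uIoc t s, ‖g y‖ * (‖u₁ y‖ + ‖u₂ y‖) := by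
  have h₁ := hg.norm_wronskian_le hR hu.fst hs ht
  have h₂ := hg.norm_wronskian_le hR hu.snd hs ht
  simp only [mul_add, ← norm_mul]
  rw [integral_add (intervalIntegrable_iff.1 (hg.intervalIntegrable_mul hR hu.fst ht.1 hs.1)).norm
    (intervalIntegrable_iff.1 (hg.intervalIntegrable_mul hR hu.snd ht.1 hs.1)).norm]
  simp only [coeffNorm]
  linarith

theorem setIntegral_mul_le (hR : Regular J Q x A) (hu : IsL2Pair J Q x A e u₁ u₂)
    (hg : SolvesOn J Q x A z g) (hs : s ∈ J) (ht : t ∈ J) {m : ℝ} (hm : 0 ≤ m)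
    (hle : ∀ y ∈ uIcc t s \ range x, coeffNorm u₁ u₂ g y ≤ m) :
    ∫ y in uIoc t s, ‖g y‖ * (‖u₁ y‖ + ‖u₂ y‖) ≤ m * ∫ y in J, (‖u₁ y‖ + ‖u₂ y‖) ^ 2 := by
  have hsub : uIoc t s ⊆ J := uIoc_subset_uIcc.trans (hR.ordConnected.uIcc_subset ht hs)
  calc ∫ y in uIoc t s, ‖g y‖ * (‖u₁ y‖ + ‖u₂ y‖)
      ≤ ∫ y in uIoc t s, m * (‖u₁ y‖ + ‖u₂ y‖) ^ 2 := by
        refine integral_mono_ae (hu.integrableOn_mul hR hg hs ht)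
          ((hu.integrableOn_sq.mono_set hsub).const_mul m) ?_
        filter_upwards [ae_restrict_mem measurableSet_uIoc,
          ae_notMem_range x Measure.restrict_le_self.absolutelyContinuous] with y hy hyx
        rw [pow_two, ← mul_assoc]
        gcongr
        exact (hu.norm_le g ⟨hsub hy, hyx⟩).trans
          (by gcongr; exact hle y ⟨uIoc_subset_uIcc hy, hyx⟩)
    _ = m * ∫ y in uIoc t s, (‖u₁ y‖ + ‖u₂ y‖) ^ 2 := integral_const_mul _ _
    _ ≤ m * ∫ y in J, (‖u₁ y‖ + ‖u₂ y‖) ^ 2 :=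
        mul_le_mul_of_nonneg_left (setIntegral_mono_set hu.integrableOn_sq
          (Eventually.of_forall fun y => by positivity) hsub.eventuallyLE) hm

theorem coeffNorm_le_two_mul (hR : Regular J Q x A) (hu : IsL2Pair J Q x A e u₁ u₂)
    (hsmall : ‖z - e‖ * ∫ t in J, (‖u₁ t‖ + ‖u₂ t‖) ^ 2 ≤ 1 / 2) (hg : SolvesOn J Q x A z g)
    (hs : s ∈ J \ range x) (ht : t ∈ J \ range x) :
    coeffNorm u₁ u₂ g s ≤ 2 * coeffNorm u₁ u₂ g t := by
  have hJ : ∀ r ∈ uIcc t s \ range x, r ∈ J \ range x :=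
    fun r hr => ⟨hR.ordConnected.uIcc_subset ht.1 hs.1 hr.1, hr.2⟩
  refine le_two_mul_of_forall_le_add_half (φ := coeffNorm u₁ u₂ g) (S := uIcc t s \ range x)
    ⟨coeffNorm u₁ u₂ g t + ‖z - e‖ * ∫ y in uIoc t s, ‖g y‖ * (‖u₁ y‖ + ‖u₂ y‖), ?_⟩
    (fun m hm r hr => ?_) ⟨right_mem_uIcc, hs.2⟩
  · refine forall_mem_image.2 fun r hr => (hu.coeffNorm_le_add hR hg (hJ r hr) ht).trans ?_
    refine add_le_add_right (mul_le_mul_of_nonneg_left ?_ (norm_nonneg _)) _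
    exact setIntegral_mono_set (hu.integrableOn_mul hR hg hs.1 ht.1)
      (Eventually.of_forall fun y => by positivity)
      (uIoc_subset_uIoc_of_uIcc_subset_uIcc (uIcc_subset_uIcc_left hr.1)).eventuallyLE
  · have hm₀ : 0 ≤ m := (coeffNorm_nonneg _ _ _ _).trans (hm r hr)
    have hInt := hu.setIntegral_mul_le hR hg (hJ r hr).1 ht.1 hm₀
      fun y hy => hm y ⟨uIcc_subset_uIcc_left hr.1 hy.1, hy.2⟩
    calc coeffNorm u₁ u₂ g r
        ≤ coeffNorm u₁ u₂ g t + ‖z - e‖ * (m * ∫ y in J, (‖u₁ y‖ + ‖u₂ y‖) ^ 2) :=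
          (hu.coeffNorm_le_add hR hg (hJ r hr) ht).trans (by gcongr)
      _ = coeffNorm u₁ u₂ g t + m * (‖z - e‖ * ∫ y in J, (‖u₁ y‖ + ‖u₂ y‖) ^ 2) := by ring
      _ ≤ coeffNorm u₁ u₂ g t + m * (1 / 2) := by gcongr
      _ = coeffNorm u₁ u₂ g t + m / 2 := by ring

theorem memLp (hR : Regular J Q x A) (hu : IsL2Pair J Q x A e u₁ u₂)
    (hsmall : ‖z - e‖ * ∫ t in J, (‖u₁ t‖ + ‖u₂ t‖) ^ 2 ≤ 1 / 2) (hg : SolvesOn J Q x A z g)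
    (ht : t ∈ J \ range x) : MemLp g 2 (volume.restrict J) := by
  refine MemLp.of_le_mul (c := 2 * coeffNorm u₁ u₂ g t) (hu.memLp_fst.norm.add hu.memLp_snd.norm)
    (hg.aestronglyMeasurable hR) ?_
  filter_upwards [ae_restrict_mem hR.isOpen.measurableSet,
    ae_notMem_range x Measure.restrict_le_self.absolutelyContinuous] with s hs hsx
  have hcoeff := hu.coeffNorm_le_two_mul hR hsmall hg ⟨hs, hsx⟩ ht
  rw [Pi.add_apply, Real.norm_of_nonneg (by positivity)]
  exact (hu.norm_le g ⟨hs, hsx⟩).trans (by gcongr)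

theorem limitCircleAt (hl : IsEnd l) (hR : Regular J Q x A) (hJ : J ∈ l)
    (hu : IsL2Pair J Q x A e u₁ u₂) : LimitCircleAt l J Q x A := by
  intro z g hg
  obtain ⟨N, hN, hNJ, hRN, hsmall⟩ := hu.exists_small hl hR hJ z
  obtain ⟨t, ht⟩ := hRN.nonempty_diff (hl.neBot.nonempty_of_mem hN)
  exact ⟨N, hN, (hu.mono hNJ).memLp hRN hsmall (hg.mono hNJ) ht⟩

theorem exists_jet_eq_zero (hl : IsEnd l) (hR : Regular J Q x A) (hJ : J ∈ l)
    (hu : IsL2Pair J Q x A e u₁ u₂) (hg : SolvesOn J Q x A z g)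
    (h₁ : Tendsto (wronskian g u₁) (l ⊓ 𝓟 (range x)ᶜ) (𝓝 0))
    (h₂ : Tendsto (wronskian g u₂) (l ⊓ 𝓟 (range x)ᶜ) (𝓝 0)) :
    ∃ s ∈ J \ range x, jet g s = 0 := by
  obtain ⟨N, hN, hNJ, hRN, hsmall⟩ := hu.exists_small hl hR hJ z
  obtain ⟨s, hs⟩ := hRN.nonempty_diff (hl.neBot.nonempty_of_mem hN)
  have huN := hu.mono hNJ
  have hlim : Tendsto (fun t => 2 * coeffNorm u₁ u₂ g t) (l ⊓ 𝓟 (range x)ᶜ) (𝓝 0) := by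
    simpa only [coeffNorm, norm_zero, add_zero, mul_zero] using (h₁.norm.add h₂.norm).const_mul 2
  have := hl.neBot_inf_compl (countable_range x)
  have hle : coeffNorm u₁ u₂ g s ≤ 0 := by
    refine ge_of_tendsto hlim ?_
    filter_upwards [inter_mem_inf hN (mem_principal_self _)] with t ht
      using huN.coeffNorm_le_two_mul hRN hsmall (hg.mono hNJ) hs ht
  exact ⟨s, ⟨hNJ hs.1, hs.2⟩, huN.jet_eq_zero hs (hle.antisymm (coeffNorm_nonneg _ _ _ _))⟩

end Countable

end IsL2Pair

end WeylAlternative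

/-! ### Boundary conditions and boundary values -/

section BoundaryValues

variable {ι : Type*} {J N : Set ℝ} {Q : ℝ → ℝ} {x : ι → ℝ} {A A' : ι → Matrix (Fin 2) (Fin 2) ℝ}
  {e z : ℂ} {f g v : ℝ → ℂ} {l m : Filter ℝ} {s t : ℝ}

theorem jet_smul (c : ℂ) (f : ℝ → ℂ) (t : ℝ) : jet (c • f) t = c • jet f t := by
  ext i
  fin_cases i
  · rfl
  · exact deriv_const_mul_field c

theorem SolvesOn.smul (hR : Regular J Q x A) (hf : SolvesOn J Q x A z f) (c : ℂ) :
    SolvesOn J Q x A z (c • f) := by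
  simpa only [zero_smul, add_zero] using hf.linearCombination hR hf c 0

theorem wronskian_smul_right (c : ℂ) (f g : ℝ → ℂ) :
    wronskian f (c • g) = fun t => c * wronskian f g t :=
  funext fun t => by rw [wronskian, jet_smul, wedge_smul_right, wronskian]

theorem SolvesOn.jet_ne_zero [Countable ι] (hR : Regular J Q x A) (hf : SolvesOn J Q x A z f)
    (hs : s ∈ J \ range x) (hfs : f s ≠ 0) (ht : t ∈ J \ range x) : jet f t ≠ 0 := by
  intro hzero
  have hjet : jet f t = jet ((0 : ℂ) • f) t := by rw [jet_smul, hzero, smul_zero]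
  refine hfs ?_
  rw [(hR.solvableOn z).eqOn hR hf (hf.smul hR 0) ht hjet hs, zero_smul, Pi.zero_apply]

/-- `v` is a non-trivial solution near the end `l`. -/
def IsNontrivialSolutionNear (l : Filter ℝ) (Q : ℝ → ℝ) (x : ι → ℝ)
    (A : ι → Matrix (Fin 2) (Fin 2) ℝ) (z : ℂ) (v : ℝ → ℂ) : Prop :=
  ∃ N ∈ l, Regular N Q x A ∧ SolvesOn N Q x A z v ∧ ∀ t ∈ N \ range x, jet v t ≠ 0

theorem IsNontrivialSolutionNear.exists_subset (hv : IsNontrivialSolutionNear l Q x A z v)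
    (hR : Regular J Q x A) (hJ : J ∈ l) : ∃ N ∈ l, N ⊆ J ∧ Regular N Q x A ∧
      SolvesOn N Q x A z v ∧ ∀ t ∈ N \ range x, jet v t ≠ 0 := by
  obtain ⟨N, hN, hRN, hvN, hne⟩ := hv
  exact ⟨N ∩ J, inter_mem hN hJ, inter_subset_right, hRN.inter hR, hvN.mono inter_subset_left,
    fun t ht => hne t ⟨ht.1.1, ht.2⟩⟩

theorem IsNontrivialSolutionNear.congr_matrix (hv : IsNontrivialSolutionNear l Q x A z v)
    (hR : Regular J Q x A) (hR' : Regular J Q x A') (hJ : J ∈ l)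
    (hA : ∀ n, x n ∈ J → A n = A' n) : IsNontrivialSolutionNear l Q x A' z v := by
  obtain ⟨N, hN, hNJ, hRN, hvN, hne⟩ := hv.exists_subset hR hJ
  exact ⟨N, hN, hR'.mono hRN.isOpen hRN.ordConnected hNJ,
    hvN.congr_matrix fun n hn => hA n (hNJ hn), hne⟩

section LagrangeBracket

variable {k : ℝ → ℂ}

theorem tendsto_wronskian_lagrangeBracket {y y' : Fin 2 → ℂ} (hk : Tendsto (jet k) (𝓝[>] t) (𝓝 y))
    (hf : Tendsto (jet f) (𝓝[>] t) (𝓝 y')) :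
    Tendsto (wronskian (fun t => starRingEnd ℂ (k t)) f) (𝓝[>] t) (𝓝 (lagrangeBracket k f t)) := by
  have hbracket : lagrangeBracket k f t = wedge (starRingEnd ℂ ∘ y) y' := by
    rw [tendsto_pi_nhds] at hk hf
    rw [lagrangeBracket, rightLim_eq_of_tendsto (f := k) (hk 0),
      rightLim_eq_of_tendsto (f := f) (hf 0), rightLim_eq_of_tendsto (f := deriv k) (hk 1),
      rightLim_eq_of_tendsto (f := deriv f) (hf 1)]
    rfl
  exact hbracket ▸ tendsto_wedge (tendsto_jet_conj hk) hf

theorem tendsto_lagrangeBracket_iff (hl : IsEnd l) (hR : Regular N Q x A) (hN : N ∈ l)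
    (hk : SolvesOn N Q x A z k) (hf : SolvesOn N Q x A e f) :
    Tendsto (lagrangeBracket k f) l (𝓝 0) ↔
      Tendsto (wronskian (fun t => starRingEnd ℂ (k t)) f) (l ⊓ 𝓟 (range x)ᶜ) (𝓝 0) := by
  have hright : ∀ t ∈ N, Tendsto (wronskian (fun t => starRingEnd ℂ (k t)) f) (𝓝[>] t)
      (𝓝 (lagrangeBracket k f t)) := fun t ht => by
    obtain ⟨y, hy⟩ := hk.exists_tendsto_jet_right hR ht
    obtain ⟨y', hy'⟩ := hf.exists_tendsto_jet_right hR ht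
    exact tendsto_wronskian_lagrangeBracket hy hy'
  refine ⟨fun h => (h.mono_left inf_le_left).congr' ?_, fun h => ?_⟩
  · filter_upwards [inter_mem_inf hN (mem_principal_self _)] with t ht
    exact tendsto_nhds_unique (hright t ht.1) (tendsto_wedge
      (hk.conj.continuousAt_jet hR ht) (hf.continuousAt_jet hR ht) |>.mono_left nhdsWithin_le_nhds)
  · rw [Metric.nhds_basis_closedBall.tendsto_right_iff] at h ⊢
    intro ε hε
    obtain ⟨U, ⟨hU, hUo, -⟩, hUε⟩ :=
      hl.hasBasis.mem_iff.1 (inter_mem hN (eventually_inf_principal.1 (h ε hε)))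
    filter_upwards [hU] with t ht
    refine Metric.isClosed_closedBall.mem_of_tendsto (hright t (hUε ht).1) ?_
    filter_upwards [nhdsWithin_le_nhds (hUo.mem_nhds ht),
      nhdsGT_le_nhdsNE t (hR.eventually_mem_diff (hUε ht).1)] with s hs hsx
    exact (hUε hs).2 hsx.2

end LagrangeBracket

/-- `f` is a square integrable solution on `J` that, in the limit circle case at the end `l`,
satisfies there the boundary condition given by `v`. -/
structure IsWeylSolution (l : Filter ℝ) (J : Set ℝ) (Q : ℝ → ℝ) (x : ι → ℝ)
    (A : ι → Matrix (Fin 2) (Fin 2) ℝ) (v : ℝ → ℂ) (e : ℂ) (f : ℝ → ℂ) : Prop where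
  solvesOn : SolvesOn J Q x A e f
  memLp : MemLp f 2 (volume.restrict J)
  tendsto_wronskian : LimitCircleAt l J Q x A →
    Tendsto (wronskian v f) (l ⊓ 𝓟 (range x)ᶜ) (𝓝 0)

namespace IsWeylSolution

theorem smul (hR : Regular J Q x A) (hf : IsWeylSolution l J Q x A v e f) (c : ℂ) :
    IsWeylSolution l J Q x A v e (c • f) where
  solvesOn := hf.solvesOn.smul hR c
  memLp := hf.memLp.const_smul c
  tendsto_wronskian hlc := by
    simpa only [wronskian_smul_right, mul_zero] using (hf.tendsto_wronskian hlc).const_mul c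

theorem congr_matrix (hA : ∀ n, x n ∈ J → A n = A' n) (hf : IsWeylSolution l J Q x A v e f) :
    IsWeylSolution l J Q x A' v e f where
  solvesOn := hf.solvesOn.congr_matrix hA
  memLp := hf.memLp
  tendsto_wronskian hlc := hf.tendsto_wronskian ((limitCircleAt_congr_matrix hA).2 hlc)

theorem conj {E : ℝ} {v : ℝ → ℝ} (hf : IsWeylSolution l J Q x A (fun t => v t) E f) :
    IsWeylSolution l J Q x A (fun t => v t) E (fun t => starRingEnd ℂ (f t)) where
  solvesOn := Complex.conj_ofReal E ▸ hf.solvesOn.conj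
  memLp := hf.memLp.star
  tendsto_wronskian hlc := by
    have hconj (t : ℝ) : wronskian (fun t => v t) (fun t => starRingEnd ℂ (f t)) t =
        starRingEnd ℂ (wronskian (fun t => v t) f t) := by
      rw [wronskian, wronskian, ← wedge_map, ← jet_conj, ← jet_conj]
      simp only [Complex.conj_ofReal]
    have hlim := (Complex.continuous_conj.tendsto 0).comp (hf.tendsto_wronskian hlc)
    rw [map_zero] at hlim
    exact hlim.congr fun t => (hconj t).symm

section Countable

variable [Countable ι]

theorem iff_of_subset (hl : IsEnd l) (hR : Regular J Q x A) (hRN : Regular N Q x A) (hN : N ∈ l)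
    (hNJ : N ⊆ J) (hf : SolvesOn J Q x A e f) (hfL : MemLp f 2 (volume.restrict J)) :
    IsWeylSolution l J Q x A v e f ↔ IsWeylSolution l N Q x A v e f := by
  have hlc := limitCircleAt_iff_of_subset hR hRN hl hN hNJ
  exact ⟨fun h => ⟨hf.mono hNJ, hfL.mono_measure (Measure.restrict_mono_set _ hNJ),
    fun h' => h.tendsto_wronskian (hlc.2 h')⟩, fun h => ⟨hf, hfL, fun h' =>
    h.tendsto_wronskian (hlc.1 h')⟩⟩

theorem congr (hR : Regular J Q x A) (hJ : J ∈ l) (hf : IsWeylSolution l J Q x A v e f)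
    (hfg : EqOn f g (J \ range x)) : IsWeylSolution l J Q x A v e g where
  solvesOn := hf.solvesOn.congr hR hfg
  memLp := by
    rw [← Measure.restrict_congr_set (diff_range_ae_eq x J)]
    refine (hf.memLp.mono_measure (Measure.restrict_mono_set _ sdiff_subset)).ae_eq ?_
    exact (ae_restrict_mem hR.isOpen_diff.measurableSet).mono hfg
  tendsto_wronskian hlc := by
    refine (hf.tendsto_wronskian hlc).congr' ?_
    filter_upwards [inter_mem_inf hJ (mem_principal_self _)] with t ht
    rw [wronskian, wronskian, eqOn_jet hR.isOpen_diff hfg ht]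

/-- If two Weyl solutions were linearly independent, then Weyl's alternative would put us in the
limit circle case, and the two boundary conditions would force the reference solution `v` to
vanish. -/
theorem wronskian_eq_zero (hl : IsEnd l) (hR : Regular J Q x A) (hJ : J ∈ l)
    (hv : IsNontrivialSolutionNear l Q x A z v) (hf : IsWeylSolution l J Q x A v e f)
    (hg : IsWeylSolution l J Q x A v e g) (ht : t ∈ J \ range x) : wronskian f g t = 0 := by
  by_contra hW
  have hg' := hg.smul hR (wronskian f g t)⁻¹
  have hpair : IsL2Pair J Q x A e f ((wronskian f g t)⁻¹ • g) :=
    { fst := hf.solvesOn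
      snd := hg'.solvesOn
      wronskian_eq := fun s hs => by
        rw [congrFun (wronskian_smul_right _ f g) s,
          hf.solvesOn.wronskian_eq hR hg.solvesOn ht hs, inv_mul_cancel₀ hW]
      memLp_fst := hf.memLp
      memLp_snd := hg'.memLp }
  have hlc := hpair.limitCircleAt hl hR hJ
  obtain ⟨N, hN, hNJ, hRN, hvN, hne⟩ := hv.exists_subset hR hJ
  obtain ⟨s, hs, hzero⟩ := (hpair.mono hNJ).exists_jet_eq_zero hl hRN hN hvN
    (hf.tendsto_wronskian hlc) (hg'.tendsto_wronskian hlc)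
  exact hne s hs hzero

end Countable

end IsWeylSolution

/-- The boundary values, along the filter `m`, of the Weyl solutions at the end `l` of `J`. -/
def boundaryValues (m l : Filter ℝ) (J : Set ℝ) (Q : ℝ → ℝ) (x : ι → ℝ)
    (A : ι → Matrix (Fin 2) (Fin 2) ℝ) (v : ℝ → ℂ) (e : ℂ) : Set (Fin 2 → ℂ) :=
  {y | ∃ f, IsWeylSolution l J Q x A v e f ∧ Tendsto (jet f) m (𝓝 y)}

theorem smul_mem_boundaryValues (hR : Regular J Q x A) {y : Fin 2 → ℂ}
    (hy : y ∈ boundaryValues m l J Q x A v e) (c : ℂ) :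
    c • y ∈ boundaryValues m l J Q x A v e := by
  obtain ⟨f, hf, hfy⟩ := hy
  exact ⟨c • f, hf.smul hR c, (hfy.const_smul c).congr fun t => (jet_smul c f t).symm⟩

theorem conj_mem_boundaryValues {v : ℝ → ℝ} {E : ℝ} {y : Fin 2 → ℂ}
    (hy : y ∈ boundaryValues m l J Q x A (fun t => v t) E) :
    starRingEnd ℂ ∘ y ∈ boundaryValues m l J Q x A (fun t => v t) E := by
  obtain ⟨f, hf, hfy⟩ := hy
  exact ⟨_, hf.conj, tendsto_jet_conj hfy⟩

theorem wedge_eq_zero_of_mem_boundaryValues [Countable ι] [m.NeBot] (hl : IsEnd l)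
    (hR : Regular J Q x A) (hJ : J ∈ l) (hm : J \ range x ∈ m)
    (hv : IsNontrivialSolutionNear l Q x A z v) {y y' : Fin 2 → ℂ}
    (hy : y ∈ boundaryValues m l J Q x A v e) (hy' : y' ∈ boundaryValues m l J Q x A v e) :
    wedge y y' = 0 := by
  obtain ⟨f, hf, hfy⟩ := hy
  obtain ⟨g, hg, hgy⟩ := hy'
  refine tendsto_nhds_unique (tendsto_wedge hfy hgy) (tendsto_const_nhds.congr' ?_)
  filter_upwards [hm] with t ht using (hf.wronskian_eq_zero hl hR hJ hv hg ht).symm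

theorem boundaryValues_congr_matrix (hA : ∀ n, x n ∈ J → A n = A' n) :
    boundaryValues m l J Q x A v e = boundaryValues m l J Q x A' v e := by
  refine Set.ext fun y => exists_congr fun f => and_congr_left' ?_
  exact ⟨.congr_matrix hA, .congr_matrix fun n hn => (hA n hn).symm⟩

theorem subset_zero_or_eq_range_smul_ofReal {S : Set (Fin 2 → ℂ)}
    (hsmul : ∀ y ∈ S, ∀ c : ℂ, c • y ∈ S) (hconj : ∀ y ∈ S, starRingEnd ℂ ∘ y ∈ S)
    (hwedge : ∀ y ∈ S, ∀ y' ∈ S, wedge y y' = 0) :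
    S ⊆ {0} ∨ ∃ u : Fin 2 → ℝ, u ≠ 0 ∧ S = range fun c : ℂ => c • (Complex.ofReal ∘ u) := by
  refine or_iff_not_imp_left.2 fun hS => ?_
  obtain ⟨y, hy, hy0 : y ≠ 0⟩ := not_subset.1 hS
  obtain ⟨d, hd⟩ := (wedge_eq_zero_iff hy0).1 (hwedge y hy _ (hconj y hy))
  obtain ⟨y₁, hy₁, hy₁0, hreal⟩ : ∃ y₁ ∈ S, y₁ ≠ 0 ∧ ∀ i, starRingEnd ℂ (y₁ i) = y₁ i := by
    have hd' (i : Fin 2) : starRingEnd ℂ (y i) = d * y i := congrFun hd i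
    obtain rfl | hd1 := eq_or_ne d (-1)
    · refine ⟨_, hsmul y hy Complex.I, smul_ne_zero Complex.I_ne_zero hy0, fun i => ?_⟩
      rw [Pi.smul_apply, smul_eq_mul, map_mul, Complex.conj_I, hd']
      ring
    · refine ⟨_, hsmul y hy (1 + d), smul_ne_zero (fun h => hd1 ?_) hy0, fun i => ?_⟩
      · linear_combination h
      · rw [Pi.smul_apply, smul_eq_mul, add_mul, one_mul, ← hd', map_add, Complex.conj_conj,
          add_comm]
  have hu : Complex.ofReal ∘ (fun i => (y₁ i).re) = y₁ :=
    funext fun i => Complex.conj_eq_iff_re.1 (hreal i)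
  refine ⟨fun i => (y₁ i).re, fun h => hy₁0 ?_, ?_⟩
  · rw [← hu, h]
    exact funext fun _ => Complex.ofReal_zero
  · rw [hu]
    refine Subset.antisymm (fun y' hy' => ?_) (range_subset_iff.2 (hsmul y₁ hy₁))
    obtain ⟨c, hc⟩ := (wedge_eq_zero_iff hy₁0).1 (hwedge y₁ hy₁ y' hy')
    exact ⟨c, hc.symm⟩

theorem boundaryValues_subset_zero_or_eq_range_smul_ofReal [Countable ι] [m.NeBot] (hl : IsEnd l)
    (hR : Regular J Q x A) (hJ : J ∈ l) (hm : J \ range x ∈ m) {v : ℝ → ℝ} {E : ℝ}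
    (hv : IsNontrivialSolutionNear l Q x A z fun t => v t) :
    boundaryValues m l J Q x A (fun t => v t) E ⊆ {0} ∨ ∃ u : Fin 2 → ℝ, u ≠ 0 ∧
      boundaryValues m l J Q x A (fun t => v t) E = range fun c : ℂ => c • (Complex.ofReal ∘ u) :=
  subset_zero_or_eq_range_smul_ofReal (fun _ hy => smul_mem_boundaryValues hR hy)
    (fun _ => conj_mem_boundaryValues) fun _ hy _ =>
      wedge_eq_zero_of_mem_boundaryValues hl hR hJ hm hv hy

end BoundaryValues

/-! ### Eigenvalues in terms of boundary values -/

theorem memLp_restrict_union {α F : Type*} {mα : MeasurableSpace α} {μ : Measure α}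
    [NormedAddCommGroup F] {p : ENNReal} {f : α → F} {s t : Set α} (hs : MeasurableSet s)
    (ht : MeasurableSet t) (hst : Disjoint s t) (hfs : MemLp f p (μ.restrict s))
    (hft : MemLp f p (μ.restrict t)) : MemLp f p (μ.restrict (s ∪ t)) := by
  rw [← memLp_indicator_iff_restrict (hs.union ht), indicator_union_of_disjoint hst]
  exact ((memLp_indicator_iff_restrict hs).2 hfs).add ((memLp_indicator_iff_restrict ht).2 hft)

section Matching

variable {ι : Type*} [Countable ι] {J : Set ℝ} {Q : ℝ → ℝ} {x : ι → ℝ}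
  {A : ι → Matrix (Fin 2) (Fin 2) ℝ} {e z : ℂ} {f v w : ℝ → ℂ} {l r : Filter ℝ} {n : ι} {p t : ℝ}

theorem memLp_restrict_of_inter_Iio_of_inter_Ioi (hJ : MeasurableSet J)
    (hleft : MemLp f 2 (volume.restrict (J ∩ Iio p)))
    (hright : MemLp f 2 (volume.restrict (J ∩ Ioi p))) : MemLp f 2 (volume.restrict J) := by
  have hunion : (J ∩ Iio p ∪ J ∩ Ioi p : Set ℝ) =ᵐ[volume] J := by
    rw [← inter_union_distrib_left, Iio_union_Ioi, ← sdiff_eq]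
    exact sdiff_null_ae_eq_self (measure_singleton p)
  rw [← Measure.restrict_congr_set hunion]
  exact memLp_restrict_union (hJ.inter measurableSet_Iio) (hJ.inter measurableSet_Ioi)
    (Iio_disjoint_Ioi_same.mono inter_subset_right inter_subset_right) hleft hright

theorem SolvesOn.ae_eq_zero_iff (hR : Regular J Q x A) (hf : SolvesOn J Q x A z f) :
    (∀ᵐ t ∂volume.restrict J, f t = 0) ↔ EqOn f 0 (J \ range x) := by
  rw [← Measure.restrict_congr_set (diff_range_ae_eq x J)]
  exact ⟨fun h => Measure.eqOn_open_of_ae_eq h hR.isOpen_diff hf.continuousOn continuousOn_const,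
    (ae_restrict_mem hR.isOpen_diff.measurableSet).mono⟩

theorem SolvesOn.jet_eq_zero_of_tendsto (hR : Regular J Q x A) (hf : SolvesOn J Q x A z f)
    (hp : p ∈ J) (hlim : Tendsto (jet f) (𝓝[<] p) (𝓝 0)) (ht : t ∈ J \ range x) :
    jet f t = 0 := by
  refine eq_of_forall_wedge_eq fun y => ?_
  obtain ⟨g, hg, rfl⟩ := hR.solvableOn z t ht y
  obtain ⟨y', hy'⟩ := hg.exists_tendsto_jet_left hR hp
  have hconst : ∀ᶠ s in 𝓝[<] p, wronskian f g t = wronskian f g s :=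
    mem_of_superset (nhdsLT_le_nhdsNE p (hR.eventually_mem_diff hp)) fun s hs =>
      hf.wronskian_eq hR hg hs ht
  calc
    wedge (jet f t) (jet g t) = wedge 0 y' :=
      tendsto_nhds_unique (tendsto_const_nhds.congr' hconst) (tendsto_wedge hlim hy')
    _ = wedge 0 (jet g t) := by simp only [wedge, Pi.zero_apply, zero_mul]

theorem exists_boundaryValues_of_isWeylSolution (hR : Regular J Q x A) (hl : IsEnd l)
    (hr : IsEnd r) (hn : x n ∈ J) (hJl : J ∩ Iio (x n) ∈ l) (hJr : J ∩ Ioi (x n) ∈ r)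
    (hfl : IsWeylSolution l J Q x A v e f) (hfr : IsWeylSolution r J Q x A w e f)
    (hf0 : ¬EqOn f 0 (J \ range x)) :
    ∃ y ∈ boundaryValues (𝓝[<] (x n)) l (J ∩ Iio (x n)) Q x A v e, y ≠ 0 ∧
      ((A n).map Complex.ofReal).mulVec y ∈
        boundaryValues (𝓝[>] (x n)) r (J ∩ Ioi (x n)) Q x A w e := by
  obtain ⟨y, hleft, hright⟩ := (hfl.solvesOn (x n) hn).2 n rfl
  refine ⟨y, ⟨f, ?_, hleft⟩, ?_, f, ?_, hright⟩
  · exact (IsWeylSolution.iff_of_subset hl hR (hR.inter_Iio _) hJl inter_subset_left hfl.solvesOn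
      hfl.memLp).1 hfl
  · rintro rfl
    exact hf0 fun t ht => congrFun (hfl.solvesOn.jet_eq_zero_of_tendsto hR hn hleft ht) 0
  · exact (IsWeylSolution.iff_of_subset hr hR (hR.inter_Ioi _) hJr inter_subset_left hfl.solvesOn
      hfl.memLp).1 hfr

theorem exists_isWeylSolution_of_boundaryValues (hR : Regular J Q x A) (hl : IsEnd l)
    (hr : IsEnd r) (hn : x n ∈ J) (hJl : J ∩ Iio (x n) ∈ l) (hJr : J ∩ Ioi (x n) ∈ r)
    {y : Fin 2 → ℂ} (hy : y ∈ boundaryValues (𝓝[<] (x n)) l (J ∩ Iio (x n)) Q x A v e)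
    (hy0 : y ≠ 0) (hAy : ((A n).map Complex.ofReal).mulVec y ∈
      boundaryValues (𝓝[>] (x n)) r (J ∩ Ioi (x n)) Q x A w e) :
    ∃ f, IsWeylSolution l J Q x A v e f ∧ IsWeylSolution r J Q x A w e f ∧
      ¬EqOn f 0 (J \ range x) := by
  obtain ⟨f, hf, hfy⟩ := hy
  obtain ⟨g, hg, hgy⟩ := hAy
  set k : ℝ → ℂ := fun t => if t < x n then f t else g t with hk
  have hfk : EqOn f k ((J ∩ Iio (x n)) \ range x) := fun t ht => (if_pos ht.1.2).symm
  have hgk : EqOn g k ((J ∩ Ioi (x n)) \ range x) := fun t ht => (if_neg (not_lt_of_gt ht.1.2)).symm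
  have hkl := hf.congr (hR.inter_Iio _) hJl hfk
  have hkr := hg.congr (hR.inter_Ioi _) hJr hgk
  have hkJ : SolvesOn J Q x A e k := hf.solvesOn.ite_lt hR.injective hfy hg.solvesOn hgy
  have hkL : MemLp k 2 (volume.restrict J) :=
    memLp_restrict_of_inter_Iio_of_inter_Ioi hR.isOpen.measurableSet hkl.memLp hkr.memLp
  refine ⟨k, (IsWeylSolution.iff_of_subset hl hR (hR.inter_Iio _) hJl inter_subset_left hkJ hkL).2
    hkl, (IsWeylSolution.iff_of_subset hr hR (hR.inter_Ioi _) hJr inter_subset_left hkJ hkL).2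
    hkr, fun hk0 => hy0 (tendsto_nhds_unique (hfy.congr' ?_) tendsto_const_nhds)⟩
  filter_upwards [nhdsLT_le_nhdsNE _ (hR.eventually_mem_diff hn), self_mem_nhdsWithin] with t ht htn
  have hjet : jet f t = jet 0 t := eqOn_jet (hR.inter_Iio _).isOpen_diff
    (hfk.trans (hk0.mono (sdiff_subset_sdiff_left inter_subset_left))) ⟨⟨ht.1, htn⟩, ht.2⟩
  rw [hjet, ← zero_smul ℂ (jet 0 t), ← jet_smul, smul_zero]

end Matching

section Interval

variable {I : Set ℤ} {J : Set ℝ} {V Q : ℝ → ℝ} {x : I → ℝ} {κ : Couplings I} {a b : EReal} {c : ℝ}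
  {E lam : ℝ} {f : ℝ → ℂ} {v w : ℝ → ℝ} {z : ℂ} {l : Filter ℝ}

theorem limitCircleLeft_iff (hab : a < b) (hV : LocallyIntegrableOn V (interval a b))
    (hc : c ∈ interval a b) (hR : Regular (interval a b) (primitive V c) x κ.matrix) :
    LimitCircleLeft a b V x κ ↔
      LimitCircleAt (leftEnd a) (interval a b) (primitive V c) x κ.matrix :=
  forall₂_congr fun _ _ =>
    imp_congr (isSolution_iff_solvesOn hV hc Subset.rfl hR) (liesLeft_iff hab)

theorem limitCircleRight_iff (hab : a < b) (hV : LocallyIntegrableOn V (interval a b))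
    (hc : c ∈ interval a b) (hR : Regular (interval a b) (primitive V c) x κ.matrix) :
    LimitCircleRight a b V x κ ↔
      LimitCircleAt (rightEnd b) (interval a b) (primitive V c) x κ.matrix :=
  forall₂_congr fun _ _ =>
    imp_congr (isSolution_iff_solvesOn hV hc Subset.rfl hR) (liesRight_iff hab)

theorem IsRealSolutionNearLeft.isNontrivialSolutionNear
    (hV : LocallyIntegrableOn V (interval a b)) (hc : c ∈ interval a b)
    (hR : Regular (interval a b) (primitive V c) x κ.matrix)
    (hv : IsRealSolutionNearLeft a b V x κ lam v) :
    IsNontrivialSolutionNear (leftEnd a) (primitive V c) x κ.matrix lam fun t => v t := by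
  obtain ⟨c', hc', hsol, s, hs, hvs⟩ := hv
  have hsub : interval a c' ⊆ interval a b := interval_subset_interval le_rfl hc'.2.le
  have hR' := hR.mono (isOpen_interval a c') (ordConnected_interval a c') hsub
  have hsol' := hsol.solvesOn hV hc hsub hR'
  exact ⟨interval a c', interval_mem_leftEnd hc'.1, hR', hsol', fun t =>
    hsol'.jet_ne_zero hR' hs (Complex.ofReal_ne_zero.2 hvs)⟩

theorem IsRealSolutionNearRight.isNontrivialSolutionNear
    (hV : LocallyIntegrableOn V (interval a b)) (hc : c ∈ interval a b)
    (hR : Regular (interval a b) (primitive V c) x κ.matrix)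
    (hw : IsRealSolutionNearRight a b V x κ lam w) :
    IsNontrivialSolutionNear (rightEnd b) (primitive V c) x κ.matrix lam fun t => w t := by
  obtain ⟨c', hc', hsol, s, hs, hws⟩ := hw
  have hsub : interval c' b ⊆ interval a b := interval_subset_interval hc'.1.le le_rfl
  have hR' := hR.mono (isOpen_interval c' b) (ordConnected_interval c' b) hsub
  have hsol' := hsol.solvesOn hV hc hsub hR'
  exact ⟨interval c' b, interval_mem_rightEnd hc'.2, hR', hsol', fun t =>
    hsol'.jet_ne_zero hR' hs (Complex.ofReal_ne_zero.2 hws)⟩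

theorem IsNontrivialSolutionNear.tendsto_lagrangeBracket_iff (hl : IsEnd l)
    (hR : Regular J Q x κ.matrix) (hJ : J ∈ l)
    (hv : IsNontrivialSolutionNear l Q x κ.matrix z fun t => v t)
    (hf : SolvesOn J Q x κ.matrix E f) :
    Tendsto (lagrangeBracket (fun t => v t) f) l (𝓝 0) ↔
      Tendsto (wronskian (fun t => v t) f) (l ⊓ 𝓟 (range x)ᶜ) (𝓝 0) := by
  obtain ⟨N, hN, hNJ, hRN, hvN, -⟩ := hv.exists_subset hR hJ
  simpa only [Complex.conj_ofReal] using
    PointInteraction.tendsto_lagrangeBracket_iff hl hRN hN hvN (hf.mono hNJ)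

theorem mem_maximalDomain_and_ae_iff (hV : LocallyIntegrableOn V (interval a b))
    (hc : c ∈ interval a b) (hR : Regular (interval a b) (primitive V c) x κ.matrix) :
    (f ∈ maximalDomain a b V x κ ∧ ∀ᵐ t ∂volume.restrict (interval a b), tau V f t = z * f t) ↔
      SolvesOn (interval a b) (primitive V c) x κ.matrix z f ∧
        MemLp f 2 (volume.restrict (interval a b)) := by
  rw [← isSolution_iff_solvesOn hV hc Subset.rfl hR, IsSolution]
  simp only [sub_eq_zero]
  refine ⟨fun ⟨⟨hL, hconn, _⟩, hτ⟩ => ⟨⟨hconn, hτ⟩, hL⟩, fun ⟨⟨hconn, hτ⟩, hL⟩ =>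
    ⟨⟨hL, hconn, (hL.const_mul z).ae_eq ?_⟩, hτ⟩⟩
  exact hτ.mono fun _ => Eq.symm

theorem mem_pointSpectrum_iff (hab : a < b) (hV : LocallyIntegrableOn V (interval a b))
    (hc : c ∈ interval a b) (hR : Regular (interval a b) (primitive V c) x κ.matrix)
    (hv : IsNontrivialSolutionNear (leftEnd a) (primitive V c) x κ.matrix lam fun t => v t)
    (hw : IsNontrivialSolutionNear (rightEnd b) (primitive V c) x κ.matrix lam fun t => w t) :
    (E : ℂ) ∈ pointSpectrum a b V x v w κ ↔ ∃ f,
      IsWeylSolution (leftEnd a) (interval a b) (primitive V c) x κ.matrix (fun t => v t) E f ∧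
      IsWeylSolution (rightEnd b) (interval a b) (primitive V c) x κ.matrix (fun t => w t) E f ∧
      ¬EqOn f 0 (interval a b \ range x) := by
  have hleft := interval_mem_leftEnd hab
  have hright := interval_mem_rightEnd hab
  have hdom (f : ℝ → ℂ) := mem_maximalDomain_and_ae_iff (f := f) (z := E) hV hc hR
  have hbl {f : ℝ → ℂ} (hf : SolvesOn (interval a b) (primitive V c) x κ.matrix E f) :=
    imp_congr (limitCircleLeft_iff hab hV hc hR)
      (hv.tendsto_lagrangeBracket_iff (isEnd_leftEnd hab) hR hleft hf)
  have hbr {f : ℝ → ℂ} (hf : SolvesOn (interval a b) (primitive V c) x κ.matrix E f) :=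
    imp_congr (limitCircleRight_iff hab hV hc hR)
      (hw.tendsto_lagrangeBracket_iff (isEnd_rightEnd hab) hR hright hf)
  refine exists_congr fun f => ⟨?_, ?_⟩
  · rintro ⟨⟨hmax, hl, hr⟩, hf0, hτ⟩
    obtain ⟨hsol, hL⟩ := (hdom f).1 ⟨hmax, hτ⟩
    exact ⟨⟨hsol, hL, (hbl hsol).1 hl⟩, ⟨hsol, hL, (hbr hsol).1 hr⟩,
      (hsol.ae_eq_zero_iff hR).not.1 hf0⟩
  · rintro ⟨hl, hr, hf0⟩
    have hsol := hl.solvesOn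
    obtain ⟨hmax, hτ⟩ := (hdom f).2 ⟨hsol, hl.memLp⟩
    exact ⟨⟨hmax, (hbl hsol).2 hl.tendsto_wronskian, (hbr hsol).2 hr.tendsto_wronskian⟩,
      (hsol.ae_eq_zero_iff hR).not.2 hf0, hτ⟩

theorem interval_inter_Iio_mem_leftEnd (hc : c ∈ interval a b) :
    interval a b ∩ Iio c ∈ leftEnd a :=
  mem_of_superset (interval_mem_leftEnd hc.1) fun _ ht =>
    ⟨⟨ht.1, ht.2.trans hc.2⟩, EReal.coe_lt_coe_iff.1 ht.2⟩

theorem interval_inter_Ioi_mem_rightEnd (hc : c ∈ interval a b) :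
    interval a b ∩ Ioi c ∈ rightEnd b :=
  mem_of_superset (interval_mem_rightEnd hc.2) fun _ ht =>
    ⟨⟨hc.1.trans ht.1, ht.2⟩, EReal.coe_lt_coe_iff.1 ht.1⟩

theorem matrix_replaceAt_of_ne {n n₀ : I} (h : n ≠ n₀) (α r θ : ℝ) :
    (κ.replaceAt n₀ α r θ).matrix n = κ.matrix n := by
  simp only [Couplings.matrix, Couplings.replaceAt, Function.update_of_ne h]

theorem matrix_replaceAt_self (κ : Couplings I) (n₀ : I) (α r θ : ℝ) :
    (κ.replaceAt n₀ α r θ).matrix n₀ = interactionMatrix α r θ := by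
  simp only [Couplings.matrix, Couplings.replaceAt, Function.update_self]

theorem r_replaceAt_pos {n₀ : I} {α r θ : ℝ} (hκ : ∀ n, 0 < κ.r n) (hr : 0 < r) (n : I) :
    0 < (κ.replaceAt n₀ α r θ).r n := by
  obtain rfl | h := eq_or_ne n n₀
  · simpa only [Couplings.replaceAt, Function.update_self] using hr
  · simpa only [Couplings.replaceAt, Function.update_of_ne h] using hκ n

theorem mem_parameterSet_iff {n₀ : I} {q : ℝ × ℝ × ℝ} (hV : LocallyIntegrableOn V (interval a b))
    (hn₀ : x n₀ ∈ interval a b) (hx_inj : Function.Injective x)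
    (hx_acc : ∀ p ∈ interval a b, ¬AccPt p (𝓟 (range x))) (hκ : ∀ n, 0 < κ.r n)
    (hv : IsRealSolutionNearLeft a b V x κ lam v) (hw : IsRealSolutionNearRight a b V x κ lam w) :
    q ∈ parameterSet a b V x v w κ n₀ E ↔ 0 < q.2.1 ∧
      ∃ y ∈ boundaryValues (𝓝[<] (x n₀)) (leftEnd a) (interval a b ∩ Iio (x n₀))
          (primitive V (x n₀)) x κ.matrix (fun t => v t) E, y ≠ 0 ∧
        ((interactionMatrix q.1 q.2.1 q.2.2).map Complex.ofReal).mulVec y ∈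
          boundaryValues (𝓝[>] (x n₀)) (rightEnd b) (interval a b ∩ Ioi (x n₀))
            (primitive V (x n₀)) x κ.matrix (fun t => w t) E := by
  refine and_congr_right fun hq => ?_
  have hab : a < b := hn₀.1.trans hn₀.2
  have hR := regular_interval hV hx_inj hx_acc hκ hn₀
  have hR' := regular_interval hV hx_inj hx_acc
    (r_replaceAt_pos (n₀ := n₀) (α := q.1) (θ := q.2.2) hκ hq) hn₀
  have hleft := interval_inter_Iio_mem_leftEnd hn₀
  have hright := interval_inter_Ioi_mem_rightEnd hn₀
  have hmatrix {n : I} (hn : x n ≠ x n₀) :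
      κ.matrix n = (κ.replaceAt n₀ q.1 q.2.1 q.2.2).matrix n :=
    (matrix_replaceAt_of_ne (ne_of_apply_ne x hn) _ _ _).symm
  have hv' := (hv.isNontrivialSolutionNear hV hn₀ hR).congr_matrix (hR.inter_Iio _)
    (hR'.inter_Iio _) hleft fun n hn => hmatrix (ne_of_lt hn.2)
  have hw' := (hw.isNontrivialSolutionNear hV hn₀ hR).congr_matrix (hR.inter_Ioi _)
    (hR'.inter_Ioi _) hright fun n hn => hmatrix (ne_of_gt hn.2)
  rw [mem_pointSpectrum_iff hab hV hn₀ hR' hv' hw',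
    boundaryValues_congr_matrix fun n hn => hmatrix (ne_of_lt hn.2),
    boundaryValues_congr_matrix fun n hn => hmatrix (ne_of_gt hn.2),
    ← matrix_replaceAt_self κ n₀ q.1 q.2.1 q.2.2]
  exact ⟨fun ⟨f, hfl, hfr, hf0⟩ => exists_boundaryValues_of_isWeylSolution hR'
    (isEnd_leftEnd hab) (isEnd_rightEnd hab) hn₀ hleft hright hfl hfr hf0, fun ⟨y, hy, hy0, hAy⟩ =>
    exists_isWeylSolution_of_boundaryValues hR' (isEnd_leftEnd hab) (isEnd_rightEnd hab) hn₀ hleft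
      hright hy hy0 hAy⟩

end Interval

/-! ### The set of matching parameters -/

theorem map_ofReal_mulVec_comp (B : Matrix (Fin 2) (Fin 2) ℝ) (u : Fin 2 → ℝ) :
    (B.map Complex.ofReal).mulVec (Complex.ofReal ∘ u) = Complex.ofReal ∘ B.mulVec u :=
  funext fun i => (RingHom.map_mulVec Complex.ofRealHom B u i).symm

theorem exists_mulVec_mem_range_smul_iff {B : Matrix (Fin 2) (Fin 2) ℝ} {u m : Fin 2 → ℝ}
    (hu : u ≠ 0) (hm : m ≠ 0) :
    (∃ y ∈ range fun c : ℂ => c • (Complex.ofReal ∘ u), y ≠ 0 ∧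
      (B.map Complex.ofReal).mulVec y ∈ range fun c : ℂ => c • (Complex.ofReal ∘ m)) ↔
      wedge m (B.mulVec u) = 0 := by
  have hwedge : wedge (Complex.ofReal ∘ m) (Complex.ofReal ∘ B.mulVec u) =
      (wedge m (B.mulVec u) : ℝ) := wedge_map Complex.ofRealHom m (B.mulVec u)
  constructor
  · rintro ⟨_, ⟨c, rfl⟩, hc, d, hd⟩
    have hc0 : c ≠ 0 := left_ne_zero_of_smul hc
    refine Complex.ofReal_eq_zero.1 (mul_left_cancel₀ hc0 ?_)
    dsimp only at hd
    rw [Matrix.mulVec_smul, map_ofReal_mulVec_comp] at hd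
    rw [← hwedge, ← wedge_smul_right, ← hd, wedge_smul_right, wedge_self, mul_zero, mul_zero]
  · intro h
    obtain ⟨d, hd⟩ := (wedge_eq_zero_iff hm).1 h
    refine ⟨_, ⟨1, one_smul ℂ _⟩, fun h0 => hu (funext fun i => ?_), d, ?_⟩
    · exact Complex.ofReal_eq_zero.1 (congrFun h0 i)
    · rw [map_ofReal_mulVec_comp, hd]
      exact funext fun i => (Complex.ofReal_mul d (m i)).symm

theorem map_interactionMatrix_mulVec_ne_zero {α r θ : ℝ} (hr : r ≠ 0) {y : Fin 2 → ℂ}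
    (hy : y ≠ 0) : ((interactionMatrix α r θ).map Complex.ofReal).mulVec y ≠ 0 := by
  intro h
  refine hy (eq_of_forall_wedge_eq fun y' => ?_)
  rw [← wedge_mulVec_of_det_eq_one (det_interactionMatrix hr), h]
  simp only [wedge, Pi.zero_apply, zero_mul]

/-- The parameters `(α, r, θ)` for which `A_{α,r,θ}` maps the line spanned by `u` to the line
spanned by `m`. -/
def matchingSet (u m : Fin 2 → ℝ) : Set (ℝ × ℝ × ℝ) :=
  {q | 0 < q.2.1 ∧ wedge m ((interactionMatrix q.1 q.2.1 q.2.2).mulVec u) = 0}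

section ParameterSet

variable {I : Set ℤ} {V : ℝ → ℝ} {x : I → ℝ} {κ : Couplings I} {a b : EReal} {n₀ : I}
  {E lam : ℝ} {v w : ℝ → ℝ}

theorem parameterSet_eq_empty_or_matchingSet (hV : LocallyIntegrableOn V (interval a b))
    (hn₀ : x n₀ ∈ interval a b) (hx_inj : Function.Injective x)
    (hx_acc : ∀ p ∈ interval a b, ¬AccPt p (𝓟 (range x))) (hκ : ∀ n, 0 < κ.r n)
    (hv : IsRealSolutionNearLeft a b V x κ lam v) (hw : IsRealSolutionNearRight a b V x κ lam w) :
    parameterSet a b V x v w κ n₀ E = ∅ ∨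
      ∃ u m, u ≠ 0 ∧ m ≠ 0 ∧ parameterSet a b V x v w κ n₀ E = matchingSet u m := by
  have hab : a < b := hn₀.1.trans hn₀.2
  have hR := regular_interval hV hx_inj hx_acc hκ hn₀
  have hnear := hR.eventually_mem_diff hn₀
  have hiff (q : ℝ × ℝ × ℝ) :=
    mem_parameterSet_iff (q := q) (E := E) hV hn₀ hx_inj hx_acc hκ hv hw
  obtain hL | ⟨u, hu, hL⟩ := boundaryValues_subset_zero_or_eq_range_smul_ofReal (E := E)
    (m := 𝓝[<] (x n₀)) (isEnd_leftEnd hab) (hR.inter_Iio _) (interval_inter_Iio_mem_leftEnd hn₀)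
    (by filter_upwards [nhdsLT_le_nhdsNE _ hnear, self_mem_nhdsWithin] with t ht htn
          using ⟨⟨ht.1, htn⟩, ht.2⟩) (hv.isNontrivialSolutionNear hV hn₀ hR)
  · refine .inl (eq_empty_of_forall_notMem fun q hq => ?_)
    obtain ⟨-, y, hy, hy0, -⟩ := (hiff q).1 hq
    exact hy0 (hL hy)
  obtain hM | ⟨m, hm, hM⟩ := boundaryValues_subset_zero_or_eq_range_smul_ofReal (E := E)
    (m := 𝓝[>] (x n₀)) (isEnd_rightEnd hab) (hR.inter_Ioi _) (interval_inter_Ioi_mem_rightEnd hn₀)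
    (by filter_upwards [nhdsGT_le_nhdsNE _ hnear, self_mem_nhdsWithin] with t ht htn
          using ⟨⟨ht.1, htn⟩, ht.2⟩) (hw.isNontrivialSolutionNear hV hn₀ hR)
  · refine .inl (eq_empty_of_forall_notMem fun q hq => ?_)
    obtain ⟨hr, y, -, hy0, hAy⟩ := (hiff q).1 hq
    exact map_interactionMatrix_mulVec_ne_zero hr.ne' hy0 (hM hAy)
  · refine .inr ⟨u, m, hu, hm, Set.ext fun q => (hiff q).trans (and_congr_right fun _ => ?_)⟩
    rw [hL, hM, exists_mulVec_mem_range_smul_iff hu hm]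

end ParameterSet

theorem mul_wedge_interactionMatrix_mulVec {α r θ : ℝ} (hr : r ≠ 0) (u m : Fin 2 → ℝ) :
    r * wedge m ((interactionMatrix α r θ).mulVec u) =
      (m 0 - α * m 1) * (Real.sin θ * u 0 + Real.cos θ * u 1) -
        r ^ 2 * m 1 * (Real.cos θ * u 0 - Real.sin θ * u 1) := by
  simp only [wedge, interactionMatrix, parabolic, hyperbolic, elliptic, Matrix.mulVec, dotProduct,
    Matrix.mul_apply, Fin.sum_univ_two, Matrix.of_apply, Matrix.cons_val_zero, Matrix.cons_val_one]
  field_simp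
  ring

theorem mem_matchingSet_iff {α r θ : ℝ} {u m : Fin 2 → ℝ} :
    (α, r, θ) ∈ matchingSet u m ↔ 0 < r ∧
      (m 0 - α * m 1) * (Real.sin θ * u 0 + Real.cos θ * u 1) -
        r ^ 2 * m 1 * (Real.cos θ * u 0 - Real.sin θ * u 1) = 0 :=
  and_congr_right fun hr => by
    rw [← mul_wedge_interactionMatrix_mulVec hr.ne', mul_eq_zero_iff_left hr.ne']

theorem setOf_cos_add_sin_eq_zero {X Y : ℝ} (hXY : X ≠ 0 ∨ Y ≠ 0) :
    ∃ θ₀, {θ | X * Real.cos θ + Y * Real.sin θ = 0} = range fun n : ℤ => n * Real.pi + θ₀ := by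
  set ζ : ℂ := ⟨Y, -X⟩
  have hζ : ‖ζ‖ ≠ 0 := norm_ne_zero_iff.2 fun h =>
    hXY.elim (· (neg_eq_zero.1 (congrArg Complex.im h))) (· (congrArg Complex.re h))
  refine ⟨ζ.arg, Set.ext fun θ => ?_⟩
  have hsin : X * Real.cos θ + Y * Real.sin θ = ‖ζ‖ * Real.sin (θ - ζ.arg) := by
    have hre : ‖ζ‖ * Real.cos ζ.arg = Y := Complex.norm_mul_cos_arg ζ
    have him : ‖ζ‖ * Real.sin ζ.arg = -X := Complex.norm_mul_sin_arg ζ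
    rw [Real.sin_sub]
    linear_combination -Real.sin θ * hre + Real.cos θ * him
  rw [mem_ofPred_eq, hsin, mul_eq_zero_iff_left hζ, Real.sin_eq_zero_iff]
  exact exists_congr fun n => eq_sub_iff_add_eq

theorem countable_and_infinite_setOf_cos_add_sin_eq_zero {X Y : ℝ} (hXY : X ≠ 0 ∨ Y ≠ 0) :
    {θ | X * Real.cos θ + Y * Real.sin θ = 0}.Countable ∧
      {θ | X * Real.cos θ + Y * Real.sin θ = 0}.Infinite := by
  obtain ⟨θ₀, hθ₀⟩ := setOf_cos_add_sin_eq_zero hXY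
  rw [hθ₀]
  exact ⟨countable_range _, infinite_range_of_injective
    ((add_left_injective θ₀).comp ((mul_left_injective₀ Real.pi_ne_zero).comp Int.cast_injective))⟩

theorem subsingleton_or_eq_of_injOn {α K : Type*} [Field K] {s : Set α} {φ : α → K}
    (hφ : InjOn φ s) (X Y : K) :
    {t ∈ s | X + φ t * Y = 0}.Subsingleton ∨ {t ∈ s | X + φ t * Y = 0} = s := by
  obtain rfl | hY := eq_or_ne Y 0
  · obtain rfl | hX := eq_or_ne X 0
    · exact .inr (sep_eq_self_iff_mem_true.2 fun _ _ => by rw [mul_zero, zero_add])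
    · refine .inl fun t ht => absurd ht.2 ?_
      rwa [mul_zero, add_zero]
  · exact .inl fun t ht t' ht' => hφ ht.1 ht'.1
      (mul_right_cancel₀ hY (add_left_cancel (ht.2.trans ht'.2.symm)))

section Slices

variable {u m : Fin 2 → ℝ}

theorem matchingSet_slice_theta_countable_and_infinite (hu : u ≠ 0) (hm : m ≠ 0) (α₀ : ℝ) {r₀ : ℝ}
    (hr₀ : 0 < r₀) : {q ∈ matchingSet u m | q.1 = α₀ ∧ q.2.1 = r₀}.Countable ∧
      {q ∈ matchingSet u m | q.1 = α₀ ∧ q.2.1 = r₀}.Infinite := by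
  set P := r₀ ^ 2 * m 1 with hP
  set S := m 0 - α₀ * m 1 with hS
  have hslice : {q ∈ matchingSet u m | q.1 = α₀ ∧ q.2.1 = r₀} = (fun θ => (α₀, r₀, θ)) ''
      {θ | (S * u 1 - P * u 0) * Real.cos θ + (S * u 0 + P * u 1) * Real.sin θ = 0} := by
    ext ⟨α, r, θ⟩
    constructor
    · rintro ⟨hq, rfl, rfl⟩
      refine ⟨θ, ?_, rfl⟩
      rw [mem_ofPred_eq]
      linear_combination (mem_matchingSet_iff.1 hq).2
    · rintro ⟨_, hθ, ⟨⟩⟩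
      rw [mem_ofPred_eq] at hθ
      exact ⟨mem_matchingSet_iff.2 ⟨hr₀, by linear_combination hθ⟩, rfl, rfl⟩
  have hPS : P ≠ 0 ∨ S ≠ 0 := by
    contrapose! hm
    have hm1 : m 1 = 0 := (mul_eq_zero_iff_left (pow_ne_zero 2 hr₀.ne')).1 (hP ▸ hm.1)
    have hm0 : m 0 = 0 := by simpa only [hS, hm1, mul_zero, sub_zero] using hm.2
    exact funext (Fin.forall_fin_two.2 ⟨hm0, hm1⟩)
  have hXY : S * u 1 - P * u 0 ≠ 0 ∨ S * u 0 + P * u 1 ≠ 0 := by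
    contrapose! hu
    have hnorm : (P * P + S * S) * (u 0 * u 0 + u 1 * u 1) = 0 := by
      linear_combination (S * u 1 - P * u 0) * hu.1 + (S * u 0 + P * u 1) * hu.2
    have hPS' : P * P + S * S ≠ 0 := by
      rwa [Ne, mul_self_add_mul_self_eq_zero, not_and_or]
    exact funext (Fin.forall_fin_two.2
      (mul_self_add_mul_self_eq_zero.1 ((mul_eq_zero_iff_left hPS').1 hnorm)))
  rw [hslice]
  obtain ⟨hcount, hinf⟩ := countable_and_infinite_setOf_cos_add_sin_eq_zero hXY
  exact ⟨hcount.image _, hinf.image fun _ _ _ _ h => congrArg (fun q => q.2.2) h⟩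

theorem matchingSet_slice_r_subsingleton_or_eq (u m : Fin 2 → ℝ) (α₀ θ₀ : ℝ) :
    {q ∈ matchingSet u m | q.1 = α₀ ∧ q.2.2 = θ₀}.Subsingleton ∨
      {q ∈ matchingSet u m | q.1 = α₀ ∧ q.2.2 = θ₀} = {α₀} ×ˢ Ioi 0 ×ˢ {θ₀} := by
  set X := (m 0 - α₀ * m 1) * (Real.sin θ₀ * u 0 + Real.cos θ₀ * u 1)
  set Y := -(m 1 * (Real.cos θ₀ * u 0 - Real.sin θ₀ * u 1))
  have hslice : {q ∈ matchingSet u m | q.1 = α₀ ∧ q.2.2 = θ₀} =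
      (fun r => (α₀, r, θ₀)) '' {r ∈ Ioi 0 | X + r ^ 2 * Y = 0} := by
    ext ⟨α, r, θ⟩
    constructor
    · rintro ⟨hq, rfl, rfl⟩
      obtain ⟨hr, heq⟩ := mem_matchingSet_iff.1 hq
      exact ⟨r, ⟨hr, by linear_combination heq⟩, rfl⟩
    · rintro ⟨_, ⟨hr, heq⟩, ⟨⟩⟩
      exact ⟨mem_matchingSet_iff.2 ⟨hr, by linear_combination heq⟩, rfl, rfl⟩
  rw [hslice]
  have hinj : InjOn (fun r : ℝ => r ^ 2) (Ioi 0) :=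
    fun r hr t ht h => (pow_left_inj₀ (mem_Ioi.1 hr).le (mem_Ioi.1 ht).le two_ne_zero).1 h
  refine (subsingleton_or_eq_of_injOn hinj X Y).imp (fun h => h.image _) fun h => ?_
  rw [h, singleton_prod, prod_singleton, image_image]

theorem matchingSet_slice_alpha_subsingleton_or_eq (u m : Fin 2 → ℝ) {r₀ : ℝ} (hr₀ : 0 < r₀)
    (θ₀ : ℝ) : {q ∈ matchingSet u m | q.2.1 = r₀ ∧ q.2.2 = θ₀}.Subsingleton ∨
      {q ∈ matchingSet u m | q.2.1 = r₀ ∧ q.2.2 = θ₀} = univ ×ˢ {r₀} ×ˢ {θ₀} := by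
  set s := Real.sin θ₀ * u 0 + Real.cos θ₀ * u 1
  set X := m 0 * s - r₀ ^ 2 * m 1 * (Real.cos θ₀ * u 0 - Real.sin θ₀ * u 1)
  set Y := -(m 1 * s)
  have hslice : {q ∈ matchingSet u m | q.2.1 = r₀ ∧ q.2.2 = θ₀} =
      (fun α => (α, r₀, θ₀)) '' {α ∈ univ | X + α * Y = 0} := by
    ext ⟨α, r, θ⟩
    constructor
    · rintro ⟨hq, rfl, rfl⟩
      exact ⟨α, ⟨mem_univ α, by linear_combination (mem_matchingSet_iff.1 hq).2⟩, rfl⟩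
    · rintro ⟨_, ⟨-, heq⟩, ⟨⟩⟩
      exact ⟨mem_matchingSet_iff.2 ⟨hr₀, by linear_combination heq⟩, rfl, rfl⟩
  rw [hslice]
  refine (subsingleton_or_eq_of_injOn (injOn_id univ) X Y).imp (fun h => h.image _) fun h => ?_
  simp only [id] at h
  rw [h, singleton_prod_singleton, prod_singleton]

end Slices

end PointInteraction

end

theorem mainTheorem3
    (a b : EReal) (hab : a < b)
    (V : ℝ → ℝ) (hV : MeasureTheory.LocallyIntegrableOn V (PointInteraction.interval a b))
    (I : Set ℤ) (x : I → ℝ) (hx_mem : ∀ n, x n ∈ PointInteraction.interval a b)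
    (hx_inj : Function.Injective x)
    (hx_acc : ∀ p ∈ PointInteraction.interval a b, ¬ AccPt p (Filter.principal (Set.range x)))
    (κ : PointInteraction.Couplings I) (hr : ∀ n, 0 < κ.r n)
    (lam : ℝ) (v w : ℝ → ℝ)
    (hv : PointInteraction.IsRealSolutionNearLeft a b V x κ lam v)
    (hw : PointInteraction.IsRealSolutionNearRight a b V x κ lam w)
    (n₀ : I) (E : ℝ) :
    (∀ α₀ r₀ : ℝ, 0 < r₀ →
      {p ∈ PointInteraction.parameterSet a b V x v w κ n₀ E | p.1 = α₀ ∧ p.2.1 = r₀} = ∅ ∨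
      ({p ∈ PointInteraction.parameterSet a b V x v w κ n₀ E |
          p.1 = α₀ ∧ p.2.1 = r₀}.Countable ∧
        {p ∈ PointInteraction.parameterSet a b V x v w κ n₀ E |
          p.1 = α₀ ∧ p.2.1 = r₀}.Infinite)) ∧
    (∀ α₀ θ₀ : ℝ,
      {p ∈ PointInteraction.parameterSet a b V x v w κ n₀ E |
          p.1 = α₀ ∧ p.2.2 = θ₀}.Subsingleton ∨
      {p ∈ PointInteraction.parameterSet a b V x v w κ n₀ E | p.1 = α₀ ∧ p.2.2 = θ₀} =
        {α₀} ×ˢ Set.Ioi (0 : ℝ) ×ˢ {θ₀}) ∧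
    (∀ r₀ θ₀ : ℝ, 0 < r₀ →
      {p ∈ PointInteraction.parameterSet a b V x v w κ n₀ E |
          p.2.1 = r₀ ∧ p.2.2 = θ₀}.Subsingleton ∨
      {p ∈ PointInteraction.parameterSet a b V x v w κ n₀ E | p.2.1 = r₀ ∧ p.2.2 = θ₀} =
        Set.univ ×ˢ {r₀} ×ˢ {θ₀}) := by
  rcases PointInteraction.parameterSet_eq_empty_or_matchingSet (n₀ := n₀) (E := E) hV (hx_mem n₀)
    hx_inj hx_acc hr hv hw with hP | ⟨u, m, hu, hm, hP⟩
  · simp only [hP, Set.sep_empty, Set.subsingleton_empty, true_or, implies_true, and_self]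
  · rw [hP]
    exact ⟨fun α₀ r₀ hr₀ => .inr
        (PointInteraction.matchingSet_slice_theta_countable_and_infinite hu hm α₀ hr₀),
      PointInteraction.matchingSet_slice_r_subsingleton_or_eq u m,
      fun r₀ θ₀ hr₀ => PointInteraction.matchingSet_slice_alpha_subsingleton_or_eq u m hr₀ θ₀⟩
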